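/- Let $n\ge 2$, let $H^{(n)}=L^2(S^1,\mathbb C^n)$ with the subspace $H^{(n)}_+$ of functions without negative Fourier modes, and let $\mathcal W(z)$ be a loop in $L_{1/2}GL(n,\mathbb C)$ (measurable, essentially bounded with essentially bounded inverse, $\sum_k |k|\,\|\mathcal W^{(k)}\|^2<\infty$) whose Fourier series at $z=\infty$ is an upper unitriangular constant matrix plus $O(1/z)$. Let $W=\mathcal W(z)H^{(n)}_+$, and assume that $W$ is in the big cell, i.e. that the orthogonal projection $W\to H^{(n)}_+$ is bijective. Identify $H^{(n)}$ with $L^2(S^1)$ by $\Xi(f_0,\dots,f_{n-1})=\sum_i z^i f_i(z^n)$. Let $D=\partial/\partial t_1$ and $\xi(t,z)=\sum_{i\ge1}t_iz^i$. The dressing operator of $W$ is the pseudodifferential operator $S_W=1+\sum_{i\ge 1}s_i(t)D^{-i}$, with coefficients in $\mathbb C[[t_1,t_2,\dots]]$, whose wave function $\psi_W(t;z)=S_W e^{\xi(t,z)}=e^{\xi(t,z)}\bigl(1+\sum_{i\ge1} s_i(t)z^{-i}\bigr)$ takes values in $\Xi(W)$ (coefficient by coefficient in $t$), and $L_W=S_WD^nS_W^{-1}$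 is the Lax operator. Suppose that $W$ is in the Burchnall–Chaundy locus: $[L_W,M]=0$ for some differential operator $M$ in $D$ of order $m$ coprime to $n$. Then there are a differential operator $M_W$ of order $m$ with $[L_W,M_W]=0$ and a Laurent series $b(z)=z^m+\sum_{k<m}b_kz^k$ in $1/z$ with complex coefficients and with $b_{ns}=0$ for all $s\in\mathbb Z$, such that $S_W^{-1}M_WS_W=b(D)$. For every such pair $(M_W,b)$, let $B(z)=b(\Lambda)$, where $\Lambda$ is the $n\times n$ matrix with ones directly below the diagonal, $z$ in the upper right corner and zeros elsewhere, and put $$C(z)=\mathcal W(z)^{-1}B(z)\,\mathcal W(z)$$ (as matrices of Laurent series in $1/z$). Then: 1. $C(z)$ is polynomial in $z$. 2. $\operatorname{trace} C(z)=0$. 3. $\max_i\,(i-j+n\deg C_{ij}(z))=m$ for every column $j$, and $\max_j\,(i-j+n\deg C_{ij}(z))=m$ for every row $i$, where $C_{ij}$ is the entry in row $i$ and column $j$, and $\deg 0=-\infty$. 4. The characteristic polynomial $p_{C(z)}(\lambda)\in\mathbb C[z,\lambda]$ defines the spectral curve of the solution: it is irreducible, and a polynomial $F(z,\lambda)\in\mathbb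 C[z,\lambda]$ satisfies $F(L_W,M_W)=0$ if and only if $p_{C(z)}(\lambda)$ divides $F$. -/

import Mathlib

open MeasureTheory AddCircle

noncomputable section

namespace GelfandDickey

/-! ## Loops and subspaces of `H⁽ⁿ⁾ = L²(S¹, ℂⁿ)`

The unit circle is `UnitAddCircle`, with `z = fourier 1` and normalised Haar measure. -/

/-- The Hilbert space `H⁽ⁿ⁾ = L²(S¹, ℂⁿ)`. -/
abbrev Hn (n : ℕ) : Type :=
  Lp (EuclideanSpace ℂ (Fin n)) 2 (haarAddCircle : Measure UnitAddCircle)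

/-- Coefficient of `f ∈ H⁽ⁿ⁾` on the basis vector `e_{i,k}` (that is, `z ^ k` in the slot `i`). -/
def vecCoeff {n : ℕ} (f : Hn n) (i : Fin n) (k : ℤ) : ℂ :=
  fourierCoeff (fun t : UnitAddCircle => f t i) k

/-- `H₊⁽ⁿ⁾`: no negative Fourier modes. -/
def HPlus (n : ℕ) : Set (Hn n) :=
  {f | ∀ (i : Fin n) (k : ℤ), k < 0 → vecCoeff f i k = 0}

/-- A matrix-valued function on the circle. -/
abbrev MatLoop (n : ℕ) : Type := UnitAddCircle → Matrix (Fin n) (Fin n) ℂ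

/-- The `k`-th Fourier coefficient `γ⁽ᵏ⁾` of a loop, entry by entry. -/
def loopCoeff {n : ℕ} (γ : MatLoop n) (k : ℤ) : Matrix (Fin n) (Fin n) ℂ :=
  Matrix.of fun i j => fourierCoeff (fun t => γ t i j) k

/-- The loop group `L_{1/2} GL(n, ℂ)`: measurable, essentially bounded loops with essentially
bounded inverse and `∑ |k| ‖γ⁽ᵏ⁾‖² < ∞` (Hilbert-Schmidt norm). -/
structure IsHalfLoop {n : ℕ} (γ : MatLoop n) : Prop where
  meas : ∀ i j, AEStronglyMeasurable (fun t => γ t i j) haarAddCircle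
  bdd : ∃ K : ℝ, ∀ᵐ t ∂haarAddCircle, ∀ i j, ‖γ t i j‖ ≤ K
  inv : ∀ᵐ t ∂haarAddCircle, IsUnit (γ t).det
  inv_bdd : ∃ K : ℝ, ∀ᵐ t ∂haarAddCircle, ∀ i j, ‖(γ t)⁻¹ i j‖ ≤ K
  half : Summable fun k : ℤ => |(k : ℝ)| * ∑ i, ∑ j, ‖loopCoeff γ k i j‖ ^ 2

/-- The Fourier series of `γ` at `z = ∞` is an upper unitriangular matrix plus `O(1 / z)`. -/
structure IsNormalized {n : ℕ} (γ : MatLoop n) : Prop where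
  pos : ∀ k : ℤ, 0 < k → loopCoeff γ k = 0
  diag : ∀ i, loopCoeff γ 0 i i = 1
  lower : ∀ i j, j < i → loopCoeff γ 0 i j = 0

/-- The subspace `W = γ H₊⁽ⁿ⁾` of `H⁽ⁿ⁾`. -/
def loopSpace {n : ℕ} (γ : MatLoop n) : Set (Hn n) :=
  {g | ∃ f ∈ HPlus n, ∀ᵐ t ∂haarAddCircle,
    (fun i => g t i) = Matrix.mulVec (γ t) (fun i => f t i)}

/-- Big cell: the orthogonal projection `W → H₊⁽ⁿ⁾` is bijective. -/
def InBigCell {n : ℕ} (W : Set (Hn n)) : Prop :=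
  ∀ g ∈ HPlus n, ∃! f : Hn n, f ∈ W ∧
    ∀ (i : Fin n) (k : ℤ), 0 ≤ k → vecCoeff f i k = vecCoeff g i k

/-- The doubly infinite sequence `a` is the Fourier series of a function in `Ξ(W) ⊆ H`, where `Ξ`
is the isometry `(f₀, …, fₙ₋₁) ↦ ∑ᵢ zⁱ fᵢ(zⁿ)`, i.e. the one that maps `e_{i,k}` to `z ^ (n k + i)`
(`i = 0, …, n - 1`). -/
def IsFourierOfMem {n : ℕ} (W : Set (Hn n)) (a : ℤ → ℂ) : Prop :=
  ∃ f ∈ W, ∀ (i : Fin n) (k : ℤ), vecCoeff f i k = a (n * k + (i : ℕ))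

/-! ## Formal pseudodifferential operators in `D = ∂ / ∂t₁` -/

/-- Formal power series in all the times `t₁, t₂, t₃, …`. -/
abbrev TimeRing : Type := MvPowerSeries ℕ+ ℂ

/-- The derivation `∂ / ∂t₁`. -/
def dt (f : TimeRing) : TimeRing := MvPowerSeries.pderiv ℂ (1 : ℕ+) f

theorem iterate_dt_zero (j : ℕ) : dt^[j] 0 = 0 :=
  Function.iterate_fixed (by simp [dt]) j

/-- A formal pseudodifferential operator `∑ₖ pₖ Dᵏ` (orders `k` bounded above). -/
@[ext]
structure PsiDO where
  coeff : ℤ → TimeRing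
  bdd : ∃ N : ℤ, ∀ k, N < k → coeff k = 0

namespace PsiDO

/-- The product, determined by `Dⁱ ∘ q = ∑ⱼ (i choose j) q⁽ʲ⁾ Dⁱ⁻ʲ` for `i ∈ ℤ`; for each order
`k` only finitely many pairs `(i, j)` contribute. -/
def mul (P Q : PsiDO) : PsiDO where
  coeff k := ∑ᶠ p : ℤ × ℕ,
    Ring.choose p.1 p.2 • (P.coeff p.1 * dt^[p.2] (Q.coeff (k - p.1 + p.2)))
  bdd := by
    obtain ⟨a, ha⟩ := P.bdd
    obtain ⟨b, hb⟩ := Q.bdd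
    refine ⟨a + b, fun k hk => finsum_eq_zero_of_forall_eq_zero fun p => ?_⟩
    by_cases h : a < p.1
    · simp [ha _ h]
    · rw [hb _ (by omega), iterate_dt_zero]
      simp

instance : Mul PsiDO := ⟨mul⟩

/-- The operator with constant coefficients `b(D)`, for `b(z) = ∑ₖ bₖ zᵏ` a Laurent series in
`1 / z`; in `LaurentSeries ℂ` the variable is `1 / z`, so `bₖ = b.coeff (-k)`. -/
def ofLaurent (b : LaurentSeries ℂ) : PsiDO where
  coeff k := MvPowerSeries.C (b.coeff (-k))
  bdd := ⟨-b.order, fun k hk => by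
    rw [HahnSeries.coeff_eq_zero_of_lt_order (by omega), map_zero]⟩

/-- `P ^ k`. -/
def npow (P : PsiDO) : ℕ → PsiDO
  | 0 => ofLaurent 1
  | k + 1 => npow P k * P

/-- `P` is a differential operator of order `m`. -/
def IsDiffOfOrder (P : PsiDO) (m : ℕ) : Prop :=
  P.coeff m ≠ 0 ∧ ∀ k : ℤ, k < 0 ∨ m < k → P.coeff k = 0

/-- `P` is of the form `1 + ∑_{i ≥ 1} sᵢ D⁻ⁱ`. -/
def IsMonicOfOrderZero (P : PsiDO) : Prop :=
  P.coeff 0 = 1 ∧ ∀ k : ℤ, 0 < k → P.coeff k = 0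

end PsiDO

/-- `F(L, M) = 0` for `F = ∑ F_{ij} xⁱ yʲ`, regarded as a polynomial in `y` over `ℂ[x]`. -/
def Annihilates (F : Polynomial (Polynomial ℂ)) (L M : PsiDO) : Prop :=
  ∀ k : ℤ, ∑ j ∈ F.support, ∑ i ∈ (F.coeff j).support,
    (F.coeff j).coeff i • (L.npow i * M.npow j).coeff k = 0

/-! ## The solution attached to `W` -/

/-- For `S = ∑ₖ sₖ Dᵏ`, the coefficient of `t ^ α z ^ l` in
`S exp(ξ(t, z)) = exp(ξ(t, z)) ∑ₖ sₖ(t) zᵏ`, where `ξ(t, z) = ∑_{i ≥ 1} tᵢ zⁱ`; the coefficient of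
`t ^ β` in `exp(ξ(t, z))` is `z ^ (∑ i βᵢ) / ∏ βᵢ!`. -/
def waveCoeff (S : PsiDO) (α : ℕ+ →₀ ℕ) (l : ℤ) : ℂ :=
  ∑ p ∈ Finset.HasAntidiagonal.antidiagonal α, (p.1.prod fun _ e => ((e.factorial : ℂ))⁻¹) *
    MvPowerSeries.coeff p.2 (S.coeff (l - ((p.1.sum fun i e => (i : ℕ) * e : ℕ) : ℤ)))

/-- `S` is the dressing operator of `W`: it is monic of order `0` and the wave function
`ψ_W(t; z) = S exp(ξ(t, z)) = exp(ξ(t, z)) (1 + O(1 / z))` takes its values in (the image under `Ξ`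
of) `W`; here it is expanded at `t = 0`. -/
def IsDressing {n : ℕ} (W : Set (Hn n)) (S : PsiDO) : Prop :=
  S.IsMonicOfOrderZero ∧ ∀ α : ℕ+ →₀ ℕ, IsFourierOfMem W (waveCoeff S α)

/-- `L = S Dⁿ S⁻¹` is the Lax operator of the solution attached to `W`, with dressing `S`. -/
def IsLax {n : ℕ} (W : Set (Hn n)) (S L : PsiDO) : Prop :=
  IsDressing W S ∧ L * S = S * PsiDO.ofLaurent (HahnSeries.single (-(n : ℤ)) 1)

/-- `W` is in the Burchnall-Chaundy locus: its Lax operator commutes with a differential operator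
of order `m`, where `m` is coprime to `n`. -/
def InBCLocus {n : ℕ} (W : Set (Hn n)) (m : ℕ) : Prop :=
  Nat.Coprime m n ∧ ∃ S L M : PsiDO, IsLax W S L ∧ M.IsDiffOfOrder m ∧ L * M = M * L

/-- Normalised data of a point in the Burchnall-Chaundy locus: `b(D) = S⁻¹ M S` for a Laurent series
`b(z) = z ^ m + …` in `1 / z` without any powers of `zⁿ`. -/
structure IsBCData {n : ℕ} (W : Set (Hn n)) (m : ℕ) (S L M : PsiDO) (b : LaurentSeries ℂ) :
    Prop where
  lax : IsLax W S L
  diff : M.IsDiffOfOrder m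
  comm : L * M = M * L
  conj : M * S = S * PsiDO.ofLaurent b
  lead : b.coeff (-(m : ℤ)) = 1
  order : ∀ k : ℤ, m < k → b.coeff (-k) = 0
  traceless : ∀ s : ℤ, b.coeff (-(n * s)) = 0

/-! ## Matrices of Laurent series in `1 / z` -/

/-- The element `z` of the field of Laurent series in `1 / z`. -/
def zVar : LaurentSeries ℂ := HahnSeries.single (-1) 1

/-- A loop without positive Fourier modes, as a matrix of series in `1 / z`. -/
def loopSeries {n : ℕ} (γ : MatLoop n) : Matrix (Fin n) (Fin n) (LaurentSeries ℂ) :=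
  Matrix.of fun i j =>
    ((PowerSeries.mk fun k : ℕ => loopCoeff γ (-(k : ℤ)) i j : PowerSeries ℂ) : LaurentSeries ℂ)

/-- The matrix `Λ`: ones below the diagonal, `z` in the upper right corner. -/
def Lam (n : ℕ) : Matrix (Fin n) (Fin n) (LaurentSeries ℂ) :=
  Matrix.of fun i j =>
    (if (i : ℕ) = j + 1 then 1 else 0) + (if (i : ℕ) = 0 ∧ (j : ℕ) + 1 = n then zVar else 0)

/-- `b(Λ) = ∑ₖ bₖ Λᵏ`. The entry `(i, j)` of `Λᵏ` is `z ^ q` if `k = n q + i - j` and is `0` if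
there is no such `q`, so that the coefficient of `z ^ q` in the entry `(i, j)` of `b(Λ)` is
`b_{n q + i - j}`. -/
def evalLam {n : ℕ} (b : LaurentSeries ℂ) : Matrix (Fin n) (Fin n) (LaurentSeries ℂ) :=
  Matrix.of fun i j => HahnSeries.ofSuppBddBelow
    (fun q : ℤ => b.coeff (n * q - (i : ℕ) + (j : ℕ))) (by
      refine ⟨min (b.order - n) 0, fun q hq => ?_⟩
      have h1 : b.order ≤ n * q - (i : ℕ) + (j : ℕ) := by
        by_contra h
        exact hq (HahnSeries.coeff_eq_zero_of_lt_order (not_le.mp h))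
      have hn : (1 : ℤ) ≤ n := by have := i.pos; omega
      have hj : ((j : ℕ) : ℤ) < n := by exact_mod_cast j.isLt
      by_contra hlt
      have h2 : q < b.order - n := lt_of_lt_of_le (not_le.mp hlt) (min_le_left _ _)
      have h3 : q < 0 := lt_of_lt_of_le (not_le.mp hlt) (min_le_right _ _)
      nlinarith)

theorem evalLam_coeff {n : ℕ} (b : LaurentSeries ℂ) (i j : Fin n) (q : ℤ) :
    (evalLam b i j).coeff q = b.coeff (n * q - (i : ℕ) + (j : ℕ)) := rfl

theorem coeff_zVar_mul (x : LaurentSeries ℂ) (q : ℤ) :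
    (zVar * x).coeff q = x.coeff (q + 1) := by
  have h := HahnSeries.coeff_single_mul_add (r := (1 : ℂ)) (x := x) (a := q + 1) (b := (-1 : ℤ))
  simpa [zVar] using h

theorem Lam_mul_evalLam {n : ℕ} (b : LaurentSeries ℂ) :
    Lam n * evalLam b = evalLam (zVar * b) := by
  ext i j q
  rw [evalLam_coeff, coeff_zVar_mul, Matrix.mul_apply]
  have hn : 0 < n := i.pos
  by_cases hi : (i : ℕ) = 0
  · rw [Finset.sum_eq_single (⟨n - 1, by omega⟩ : Fin n)]
    · have h : Lam n i ⟨n - 1, by omega⟩ = zVar := by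
        simp [Lam, hi]
        omega
      rw [h, coeff_zVar_mul, evalLam_coeff]
      congr 1
      push_cast [hi, Nat.cast_sub (Nat.succ_le_of_lt hn)]
      ring
    · intro l _ hl
      have : ¬ ((l : ℕ) + 1 = n) := fun h => hl (Fin.ext (by simp; omega))
      simp [Lam, hi, this]
    · simp
  · rw [Finset.sum_eq_single (⟨i - 1, by omega⟩ : Fin n)]
    · have h : Lam n i ⟨i - 1, by omega⟩ = 1 := by
        simp [Lam, hi]
        omega
      rw [h, one_mul, evalLam_coeff]
      congr 1
      push_cast [Nat.cast_sub (Nat.one_le_iff_ne_zero.mpr hi)]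
      ring
    · intro l _ hl
      have : ¬ ((i : ℕ) = l + 1) := fun h => hl (Fin.ext (by simp; omega))
      simp [Lam, hi, this]
    · simp

theorem evalLam_one {n : ℕ} : evalLam (1 : LaurentSeries ℂ) = (1 : Matrix (Fin n) (Fin n) _) := by
  ext i j q
  have hn : 0 < n := i.pos
  have hi : ((i : ℕ) : ℤ) < n := by exact_mod_cast i.isLt
  have hj : ((j : ℕ) : ℤ) < n := by exact_mod_cast j.isLt
  rw [evalLam_coeff, HahnSeries.coeff_one, Matrix.one_apply]
  by_cases hij : i = j
  · subst hij
    simp [HahnSeries.coeff_one, hn.ne']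
  · have : ¬ ((n : ℤ) * q - (i : ℕ) + (j : ℕ) = 0) := by
      intro h
      have hne : ((i : ℕ) : ℤ) ≠ (j : ℕ) := by
        intro h'
        exact hij (Fin.ext (by exact_mod_cast h'))
      have hq : q = 0 := by
        by_contra hq
        rcases lt_or_gt_of_ne hq with h0 | h0 <;> nlinarith
      subst hq
      omega
    simp [hij, this]

/-- The formula for `evalLam` does evaluate powers of `z` at the matrix `Λ`. -/
theorem evalLam_pow {n : ℕ} (k : ℕ) : evalLam (zVar ^ k) = Lam n ^ k := by
  induction k with
  | zero => simpa using evalLam_one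
  | succ k ih => rw [pow_succ', pow_succ', ← Lam_mul_evalLam, ih]

/-- A matrix over `ℂ[z]`, as a matrix of Laurent series in `1 / z`. -/
def polySeries {n : ℕ} (C : Matrix (Fin n) (Fin n) (Polynomial ℂ)) :
    Matrix (Fin n) (Fin n) (LaurentSeries ℂ) :=
  C.map fun p => Polynomial.aeval zVar p

end GelfandDickey

end

open Polynomial

/-!
Under `Ξ` the space `W` becomes the subspace `V = Ξ(Γ ℂ[z]ⁿ)` of the field `ℂ((1/z))`, where `Γ` is
the Fourier series of the loop; `Γ` is unipotent at infinity, so that it preserves degrees and `V`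
contains no nonzero series of negative degree. The values of the `t₁`-derivatives of the wave
function at `t = 0` have the degrees `0, 1, 2, …`, hence they form a basis of `V`. Therefore a
differential operator `M` with `S⁻¹ M S = b(D)` gives `b V ⊆ V`. Conversely, if `b V ⊆ V`, then
`X = S b(D) S⁻¹` is a differential operator: the wave function `(X - X₊) S exp ξ` is `exp ξ` times a
series of negative degree in `z`, and it has values in `V`, so it vanishes.

Multiplication by `b` is `b(Λ)` on vectors, and `C = Γ⁻¹ b(Λ) Γ` is its matrix in the basis of `V`
over `ℂ[zⁿ]` given by the columns of `Γ`; hence `C` is polynomial. Its trace is that of `b(Λ)`,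
which only involves the powers of `zⁿ` in `b`. Since `Γ` preserves degrees, `C` raises them by
exactly `m`.

Conjugation by `S` turns `F(L, M) = 0` into `F(zⁿ, b(z)) = 0`. A nonzero `F` of degree less than `n`
in `λ` is not in the kernel of `F ↦ F(zⁿ, b(z))`, because its terms have degrees `n a + m j` with
`0 ≤ j < n`, which are distinct as `m` is coprime to `n`. By Cayley-Hamilton the characteristic
polynomial of `C` is in the kernel; being monic of degree `n`, it generates this kernel, which is
prime because `ℂ((1/z))` is a field.
-/

noncomputable section

namespace GelfandDickey

/-! ## The ring of pseudodifferential operators -/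

theorem dt_zsmul (c : ℤ) (f : TimeRing) : dt (c • f) = c • dt f := map_zsmul _ c f

theorem dt_sum {ι : Type*} (s : Finset ι) (f : ι → TimeRing) :
    dt (∑ i ∈ s, f i) = ∑ i ∈ s, dt (f i) := map_sum _ f s

theorem dt_mul (f g : TimeRing) : dt (f * g) = f * dt g + g * dt f := Derivation.leibniz _ f g

theorem dt_C (c : ℂ) : dt (MvPowerSeries.C c) = 0 :=
  Derivation.map_algebraMap (MvPowerSeries.pderiv ℂ (1 : ℕ+)) c

theorem iterate_dt_add (j : ℕ) (f g : TimeRing) : dt^[j] (f + g) = dt^[j] f + dt^[j] g :=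
  iterate_map_add (MvPowerSeries.pderiv ℂ (1 : ℕ+)) j f g

theorem iterate_dt_of_dt_eq_zero {f : TimeRing} (hf : dt f = 0) {j : ℕ} (hj : j ≠ 0) :
    dt^[j] f = 0 := by
  obtain ⟨j, rfl⟩ := Nat.exists_eq_succ_of_ne_zero hj
  rw [Function.iterate_succ_apply, hf, iterate_dt_zero]

namespace PsiDO

/-- `P` has order at most `a`. -/
def HasOrderLE (P : PsiDO) (a : ℤ) : Prop := ∀ k, a < k → P.coeff k = 0

theorem exists_hasOrderLE (P : PsiDO) : ∃ a, P.HasOrderLE a := P.bdd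

theorem HasOrderLE.mono {P : PsiDO} {a b : ℤ} (h : P.HasOrderLE a) (hab : a ≤ b) :
    P.HasOrderLE b := fun k hk => h k (hab.trans_lt hk)

/-- The coefficient sequences of pseudodifferential operators, through which `PsiDO` gets its
module structure. -/
def coeffSubmodule : Submodule TimeRing (ℤ → TimeRing) where
  carrier := {f | ∃ N : ℤ, ∀ k, N < k → f k = 0}
  zero_mem' := ⟨0, fun _ _ => rfl⟩
  add_mem' := by
    rintro f g ⟨a, hf⟩ ⟨b, hg⟩
    refine ⟨max a b, fun k hk => ?_⟩
    rw [Pi.add_apply, hf k (by omega), hg k (by omega), add_zero]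
  smul_mem' := by
    rintro c f ⟨a, hf⟩
    exact ⟨a, fun k hk => by rw [Pi.smul_apply, hf k hk, smul_zero]⟩

/-- An operator is its coefficient sequence. -/
def equivCoeff : PsiDO ≃ coeffSubmodule where
  toFun P := ⟨P.coeff, P.bdd⟩
  invFun f := ⟨f.1, f.2⟩

instance : AddCommGroup PsiDO := equivCoeff.addCommGroup

instance : Module TimeRing PsiDO := equivCoeff.module TimeRing

@[simp] theorem coeff_zero (k : ℤ) : (0 : PsiDO).coeff k = 0 := rfl

@[simp] theorem coeff_add (P Q : PsiDO) (k : ℤ) : (P + Q).coeff k = P.coeff k + Q.coeff k := rfl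

@[simp] theorem coeff_sub (P Q : PsiDO) (k : ℤ) : (P - Q).coeff k = P.coeff k - Q.coeff k := rfl

@[simp] theorem coeff_smul (c : TimeRing) (P : PsiDO) (k : ℤ) :
    (c • P).coeff k = c * P.coeff k := rfl

theorem coeff_sum {ι : Type*} (s : Finset ι) (f : ι → PsiDO) (k : ℤ) :
    (∑ i ∈ s, f i).coeff k = ∑ i ∈ s, (f i).coeff k :=
  map_sum (AddMonoidHom.mk' (fun P : PsiDO => P.coeff k) fun _ _ => rfl) f s

theorem hasOrderLE_zero (a : ℤ) : (0 : PsiDO).HasOrderLE a := fun _ _ => rfl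

theorem HasOrderLE.add {P Q : PsiDO} {a : ℤ} (hP : P.HasOrderLE a) (hQ : Q.HasOrderLE a) :
    (P + Q).HasOrderLE a := fun k hk => by rw [coeff_add, hP k hk, hQ k hk, add_zero]

theorem HasOrderLE.sub {P Q : PsiDO} {a : ℤ} (hP : P.HasOrderLE a) (hQ : Q.HasOrderLE a) :
    (P - Q).HasOrderLE a := fun k hk => by rw [coeff_sub, hP k hk, hQ k hk, sub_zero]

theorem eq_of_forall_hasOrderLE_sub {P Q : PsiDO} (h : ∀ a, (P - Q).HasOrderLE a) : P = Q := by
  ext1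
  funext k
  exact sub_eq_zero.mp (h (k - 1) k (by omega))

theorem exists_top_coeff {P : PsiDO} (hP : P ≠ 0) : ∃ a, P.coeff a ≠ 0 ∧ P.HasOrderLE a := by
  obtain ⟨N, hN⟩ := P.exists_hasOrderLE
  have hne : ∃ k, P.coeff k ≠ 0 := by
    by_contra! h
    exact hP (PsiDO.ext (funext h))
  obtain ⟨a, ha, hmax⟩ := Int.exists_greatest_of_bdd (P := fun k => P.coeff k ≠ 0)
    ⟨N, fun k hk => not_lt.mp fun h => hk (hN k h)⟩ hne
  exact ⟨a, ha, fun i hi => by_contra fun h => (hmax i h).not_gt hi⟩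

/-- The operator `Dⁱ`. -/
def Dpow (i : ℤ) : PsiDO where
  coeff k := if k = i then 1 else 0
  bdd := ⟨i, fun _ hk => if_neg (by omega)⟩

theorem coeff_Dpow (i k : ℤ) : (Dpow i).coeff k = if k = i then 1 else 0 := rfl

theorem coeff_ofLaurent (b : LaurentSeries ℂ) (k : ℤ) :
    (ofLaurent b).coeff k = MvPowerSeries.C (b.coeff (-k)) := rfl

theorem dt_coeff_ofLaurent (b : LaurentSeries ℂ) (k : ℤ) : dt ((ofLaurent b).coeff k) = 0 :=
  dt_C _

theorem ofLaurent_single (i : ℤ) : ofLaurent (HahnSeries.single (-i) 1) = Dpow i := by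
  ext1
  funext k
  simp only [coeff_ofLaurent, coeff_Dpow, HahnSeries.coeff_single, neg_inj]
  split_ifs <;> simp

theorem hasOrderLE_Dpow (i : ℤ) : (Dpow i).HasOrderLE i := fun _ hk => if_neg (by omega)

theorem exists_eq_sum_Dpow_add (P : PsiDO) (N : ℤ) :
    ∃ (s : Finset ℤ) (R : PsiDO), R.HasOrderLE N ∧ P = ∑ i ∈ s, P.coeff i • Dpow i + R := by
  obtain ⟨a, ha⟩ := P.exists_hasOrderLE
  refine ⟨Finset.Ioc N a, P - ∑ i ∈ Finset.Ioc N a, P.coeff i • Dpow i, fun k hk => ?_, by abel⟩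
  simp only [coeff_sub, coeff_sum, coeff_smul, coeff_Dpow, mul_ite, mul_one, mul_zero,
    Finset.sum_ite_eq, Finset.mem_Ioc]
  split_ifs with h
  · exact sub_self _
  · rw [ha k (by omega), sub_zero]

theorem eq_sum_Dpow {P : PsiDO} {s : Finset ℤ} (h : ∀ k ∉ s, P.coeff k = 0) :
    P = ∑ i ∈ s, P.coeff i • Dpow i := by
  ext1
  funext k
  simp only [coeff_sum, coeff_smul, coeff_Dpow, mul_ite, mul_one, mul_zero, Finset.sum_ite_eq]
  split_ifs with hk
  exacts [rfl, h k hk]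

theorem finite_support_mul (P Q : PsiDO) (k : ℤ) : (Function.support fun p : ℤ × ℕ =>
    Ring.choose p.1 p.2 • (P.coeff p.1 * dt^[p.2] (Q.coeff (k - p.1 + p.2)))).Finite := by
  obtain ⟨a, ha⟩ := P.exists_hasOrderLE
  obtain ⟨b, hb⟩ := Q.exists_hasOrderLE
  refine ((Set.finite_Icc (k - b) a).prod (Set.finite_Iio (a + b - k + 1).toNat)).subset ?_
  rintro ⟨i, j⟩ hp
  have hi : i ≤ a := not_lt.mp fun h => hp (by simp [ha _ h])
  have hj : k - i + j ≤ b := not_lt.mp fun h => hp (by simp [hb _ h, iterate_dt_zero])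
  simp only [Set.mem_prod, Set.mem_Icc, Set.mem_Iio]
  omega

theorem coeff_mul_eq_finsum_finsum (P Q : PsiDO) (k : ℤ) : (P * Q).coeff k =
    ∑ᶠ (i : ℤ) (j : ℕ), Ring.choose i j • (P.coeff i * dt^[j] (Q.coeff (k - i + j))) :=
  finsum_curry _ (finite_support_mul P Q k)

theorem coeff_Dpow_mul_eq_finsum (i : ℤ) (Q : PsiDO) (k : ℤ) : (Dpow i * Q).coeff k =
    ∑ᶠ j : ℕ, Ring.choose i j • dt^[j] (Q.coeff (k - i + j)) := by
  rw [coeff_mul_eq_finsum_finsum, finsum_eq_single _ i fun l hl => by simp [coeff_Dpow, hl]]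
  simp [coeff_Dpow]

theorem coeff_Dpow_mul {Q : PsiDO} {b i k : ℤ} {T : ℕ} (hQ : Q.HasOrderLE b)
    (hT : i + b - k < T) : (Dpow i * Q).coeff k =
      ∑ j ∈ Finset.range T, Ring.choose i j • dt^[j] (Q.coeff (k - i + j)) := by
  rw [coeff_Dpow_mul_eq_finsum]
  refine finsum_eq_sum_of_support_subset _ fun j hj => ?_
  have : k - i + j ≤ b := not_lt.mp fun h => hj (by simp [hQ _ h, iterate_dt_zero])
  simp only [Finset.coe_range, Set.mem_Iio]
  omega

theorem coeff_Dpow_mul_of_dt_eq_zero {Q : PsiDO} (hQ : ∀ k, dt (Q.coeff k) = 0) (i k : ℤ) :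
    (Dpow i * Q).coeff k = Q.coeff (k - i) := by
  rw [coeff_Dpow_mul_eq_finsum, finsum_eq_single _ 0 fun j hj => by
    rw [iterate_dt_of_dt_eq_zero (hQ _) hj, smul_zero]]
  simp

theorem coeff_mul (P Q : PsiDO) (k : ℤ) :
    (P * Q).coeff k = ∑ᶠ i, P.coeff i * (Dpow i * Q).coeff k := by
  rw [coeff_mul_eq_finsum_finsum]
  refine finsum_congr fun i => ?_
  rw [coeff_Dpow_mul_eq_finsum, mul_finsum]
  simp only [mul_smul_comm]

theorem coeff_mul_of_dt_eq_zero (P : PsiDO) {Q : PsiDO} (hQ : ∀ k, dt (Q.coeff k) = 0) (k : ℤ) :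
    (P * Q).coeff k = ∑ᶠ i, P.coeff i * Q.coeff (k - i) := by
  simp only [coeff_mul P Q k, coeff_Dpow_mul_of_dt_eq_zero hQ]

theorem coeff_mul_Dpow (P : PsiDO) (i k : ℤ) : (P * Dpow i).coeff k = P.coeff (k - i) := by
  have hdt : ∀ k, dt ((Dpow i).coeff k) = 0 := ofLaurent_single i ▸ dt_coeff_ofLaurent _
  rw [coeff_mul_of_dt_eq_zero P hdt, finsum_eq_single _ (k - i) fun l hl => ?_]
  · simp [coeff_Dpow]
  · rw [coeff_Dpow, if_neg (by omega), mul_zero]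

theorem coeff_Dpow_mul_eq_zero {Q : PsiDO} {b i k : ℤ} (hQ : Q.HasOrderLE b) (hk : i + b < k) :
    (Dpow i * Q).coeff k = 0 := by
  rw [coeff_Dpow_mul (T := 0) hQ (by simpa using hk), Finset.sum_range_zero]

theorem finite_support_coeff_mul (P Q : PsiDO) (k : ℤ) :
    (Function.support fun i => P.coeff i * (Dpow i * Q).coeff k).Finite := by
  obtain ⟨a, ha⟩ := P.exists_hasOrderLE
  obtain ⟨b, hb⟩ := Q.exists_hasOrderLE
  refine (Set.finite_Icc (k - b) a).subset fun i hi => ⟨?_, ?_⟩ <;> by_contra! h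
  · exact hi (mul_eq_zero_of_right _ (coeff_Dpow_mul_eq_zero hb (by omega)))
  · exact hi (mul_eq_zero_of_left (ha i h) _)

theorem HasOrderLE.mul {P Q : PsiDO} {a b : ℤ} (hP : P.HasOrderLE a) (hQ : Q.HasOrderLE b) :
    (P * Q).HasOrderLE (a + b) := fun k hk => by
  rw [coeff_mul]
  refine finsum_eq_zero_of_forall_eq_zero fun i => ?_
  rcases lt_or_ge a i with h | h
  · rw [hP i h, zero_mul]
  · rw [coeff_Dpow_mul_eq_zero hQ (by omega), mul_zero]

theorem coeff_mul_add {P Q : PsiDO} {a b : ℤ} (hP : P.HasOrderLE a) (hQ : Q.HasOrderLE b) :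
    (P * Q).coeff (a + b) = P.coeff a * Q.coeff b := by
  rw [coeff_mul, finsum_eq_single _ a fun i hi => ?_, coeff_Dpow_mul (T := 1) hQ (by simp)]
  · simp
  · rcases lt_or_gt_of_ne hi with h | h
    · rw [coeff_Dpow_mul_eq_zero hQ (by omega), mul_zero]
    · rw [hP i h, zero_mul]

instance : NoZeroDivisors PsiDO where
  eq_zero_or_eq_zero_of_mul_eq_zero {P Q} h := by
    by_contra! hPQ
    obtain ⟨a, ha, hPa⟩ := exists_top_coeff hPQ.1
    obtain ⟨b, hb, hQb⟩ := exists_top_coeff hPQ.2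
    refine mul_ne_zero ha hb ?_
    rw [← coeff_mul_add hPa hQb, h, coeff_zero]

theorem Dpow_mul_add (i : ℤ) (Q R : PsiDO) : Dpow i * (Q + R) = Dpow i * Q + Dpow i * R := by
  obtain ⟨a, hQ⟩ := Q.exists_hasOrderLE
  obtain ⟨b, hR⟩ := R.exists_hasOrderLE
  replace hQ := hQ.mono (le_max_left a b)
  replace hR := hR.mono (le_max_right a b)
  ext1
  funext k
  have hT : i + max a b - k < ((i + max a b - k + 1).toNat : ℤ) := by omega
  simp only [coeff_add, coeff_Dpow_mul (hQ.add hR) hT, coeff_Dpow_mul hQ hT, coeff_Dpow_mul hR hT,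
    iterate_dt_add, smul_add, Finset.sum_add_distrib]

instance : NonUnitalNonAssocRing PsiDO where
  __ := (inferInstance : AddCommGroup PsiDO)
  left_distrib P Q R := by
    ext1
    funext k
    rw [coeff_add, coeff_mul, coeff_mul P Q, coeff_mul P R]
    simp only [Dpow_mul_add, coeff_add, mul_add]
    exact finsum_add_distrib (finite_support_coeff_mul P Q k) (finite_support_coeff_mul P R k)
  right_distrib P Q R := by
    ext1
    funext k
    rw [coeff_add, coeff_mul, coeff_mul P R, coeff_mul Q R]
    simp only [coeff_add, add_mul]
    exact finsum_add_distrib (finite_support_coeff_mul P R k) (finite_support_coeff_mul Q R k)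
  zero_mul P := by
    obtain ⟨b, hb⟩ := P.exists_hasOrderLE
    ext1
    funext k
    exact (hasOrderLE_zero (k - 1 - b)).mul hb k (by omega)
  mul_zero P := by
    obtain ⟨a, ha⟩ := P.exists_hasOrderLE
    ext1
    funext k
    exact ha.mul (hasOrderLE_zero (k - 1 - a)) k (by omega)

instance : IsScalarTower TimeRing PsiDO PsiDO where
  smul_assoc c P Q := by
    ext1
    funext k
    rw [smul_eq_mul, smul_eq_mul, coeff_smul, coeff_mul, coeff_mul P, mul_finsum]
    simp only [coeff_smul, mul_assoc]

theorem coeff_D_mul (Q : PsiDO) (k : ℤ) :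
    (Dpow 1 * Q).coeff k = Q.coeff (k - 1) + dt (Q.coeff k) := by
  have hchoose : ∀ j : ℕ, Ring.choose (1 : ℤ) (j + 1 + 1) = 0 := fun j => by
    have := Ring.choose_natCast (R := ℤ) 1 (j + 1 + 1)
    simpa [Nat.choose_eq_zero_of_lt] using this
  obtain ⟨b, hb⟩ := Q.exists_hasOrderLE
  rw [coeff_Dpow_mul (T := (1 + b - k + 1).toNat + 2) hb (by push_cast; omega),
    Finset.sum_range_succ', Finset.sum_range_succ']
  simp only [hchoose, zero_smul, Finset.sum_const_zero]
  simp [add_comm]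

theorem D_mul_smul (c : TimeRing) (P : PsiDO) :
    Dpow 1 * (c • P) = c • (Dpow 1 * P) + dt c • P := by
  ext1
  funext k
  simp only [coeff_D_mul, coeff_smul, coeff_add, dt_mul]
  ring

theorem D_mul_Dpow_mul (i : ℤ) (Q : PsiDO) : Dpow 1 * (Dpow i * Q) = Dpow (1 + i) * Q := by
  obtain ⟨b, hb⟩ := Q.exists_hasOrderLE
  ext1
  funext k
  set T := (i + b - k + 1).toNat
  rw [coeff_D_mul, coeff_Dpow_mul (T := T + 1) hb (by push_cast; omega),
    coeff_Dpow_mul (T := T) hb (by omega), coeff_Dpow_mul (T := T + 1) hb (by push_cast; omega),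
    dt_sum, Finset.sum_range_succ', Finset.sum_range_succ', add_right_comm,
    ← Finset.sum_add_distrib]
  congr 1
  · refine Finset.sum_congr rfl fun j _ => ?_
    rw [dt_zsmul, ← Function.iterate_succ_apply' dt, add_comm 1 i, Ring.choose_succ_succ,
      add_smul, add_comm]
    congr 4 <;> push_cast <;> ring
  · simp [sub_sub]

theorem Dpow_mul_Dpow (i j : ℤ) : Dpow i * Dpow j = Dpow (i + j) := by
  ext1
  funext k
  simp only [coeff_mul_Dpow, coeff_Dpow, sub_eq_iff_eq_add]

theorem D_mul_mul (Q R : PsiDO) : Dpow 1 * (Q * R) = Dpow 1 * Q * R := by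
  obtain ⟨b, hb⟩ := R.exists_hasOrderLE
  refine eq_of_forall_hasOrderLE_sub fun a => ?_
  obtain ⟨s, T, hT, hQ⟩ := Q.exists_eq_sum_Dpow_add (a - 1 - b)
  have hD := hasOrderLE_Dpow 1
  have htail : (Dpow 1 * (T * R) - Dpow 1 * T * R).HasOrderLE a :=
    ((hD.mul (hT.mul hb)).mono (by omega)).sub (((hD.mul hT).mul hb).mono (by omega))
  rw [hQ]
  simpa only [add_mul, mul_add, Finset.sum_mul, Finset.mul_sum, smul_mul_assoc, D_mul_smul,
    D_mul_Dpow_mul, Dpow_mul_Dpow, add_sub_add_left_eq_sub] using htail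

protected theorem Dpow_zero_mul (P : PsiDO) : Dpow 0 * P = P := by
  ext1
  funext k
  rw [coeff_Dpow_mul_eq_finsum, finsum_eq_single _ 0 fun j hj => by
    rw [Ring.choose_zero_pos ℤ (Nat.pos_of_ne_zero hj), zero_smul]]
  simp

theorem Dpow_mul_mul (i : ℤ) (Q R : PsiDO) : Dpow i * (Q * R) = Dpow i * Q * R := by
  have hD : Dpow 1 ≠ 0 := fun h => one_ne_zero (congrArg (fun P => P.coeff 1) h)
  induction i using Int.induction_on with
  | zero => rw [PsiDO.Dpow_zero_mul, PsiDO.Dpow_zero_mul]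
  | succ i ih => rw [add_comm, ← D_mul_Dpow_mul, ih, D_mul_mul, D_mul_Dpow_mul]
  | pred i ih =>
    refine sub_eq_zero.mp ((mul_eq_zero_iff_left hD).mp ?_)
    rw [mul_sub, D_mul_Dpow_mul, D_mul_mul, D_mul_Dpow_mul, add_sub_cancel, ih, sub_self]

protected theorem mul_assoc (P Q R : PsiDO) : P * Q * R = P * (Q * R) := by
  obtain ⟨b, hb⟩ := Q.exists_hasOrderLE
  obtain ⟨c, hc⟩ := R.exists_hasOrderLE
  refine eq_of_forall_hasOrderLE_sub fun a => ?_
  obtain ⟨s, T, hT, hP⟩ := P.exists_eq_sum_Dpow_add (a - b - c)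
  have htail : (T * Q * R - T * (Q * R)).HasOrderLE a :=
    (((hT.mul hb).mul hc).mono (by omega)).sub ((hT.mul (hb.mul hc)).mono (by omega))
  rw [hP]
  simpa only [add_mul, Finset.sum_mul, smul_mul_assoc, Dpow_mul_mul, add_sub_add_left_eq_sub]
    using htail

instance : One PsiDO := ⟨ofLaurent 1⟩

theorem one_eq_Dpow_zero : (1 : PsiDO) = Dpow 0 := ofLaurent_single 0

instance : Ring PsiDO where
  __ := (inferInstance : NonUnitalNonAssocRing PsiDO)
  mul_assoc := PsiDO.mul_assoc
  one_mul P := by rw [one_eq_Dpow_zero, PsiDO.Dpow_zero_mul]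
  mul_one P := by
    ext1
    funext k
    rw [one_eq_Dpow_zero, coeff_mul_Dpow, sub_zero]

instance : Nontrivial PsiDO :=
  ⟨Dpow 0, 0, fun h => one_ne_zero (congrArg (fun P : PsiDO => P.coeff 0) h)⟩

instance : IsDomain PsiDO := NoZeroDivisors.to_isDomain _

theorem npow_eq_pow (P : PsiDO) (k : ℕ) : P.npow k = P ^ k := by
  induction k with
  | zero => exact (pow_zero P).symm
  | succ k ih => rw [pow_succ, ← ih]; rfl

end PsiDO

namespace PsiDO

theorem exists_hasOrderLE_sub_of_succ {f : ℕ → PsiDO} {q : ℤ}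
    (hf : ∀ d : ℕ, (f (d + 1) - f d).HasOrderLE (q - d)) :
    ∃ P : PsiDO, ∀ d : ℕ, (P - f d).HasOrderLE (q - d) := by
  have hstable : ∀ d e : ℕ, (f (d + e) - f d).HasOrderLE (q - d) := by
    intro d e
    induction e with
    | zero => rw [add_zero, sub_self]; exact hasOrderLE_zero _
    | succ e ih =>
      rw [← add_assoc, ← sub_add_sub_cancel _ (f (d + e))]
      exact ((hf (d + e)).mono (by push_cast; omega)).add ih
  obtain ⟨N, hN⟩ := (f 0).exists_hasOrderLE
  refine ⟨⟨fun k => (f (q - k + 1).toNat).coeff k, max q N, fun k hk => ?_⟩, fun d k hk => ?_⟩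
  · rw [show (q - k + 1).toNat = 0 by omega]
    exact hN k (by omega)
  · obtain ⟨e, rfl⟩ := Nat.exists_eq_add_of_le (show (q - k + 1).toNat ≤ d by omega)
    have := hstable (q - k + 1).toNat e k (by omega)
    rw [coeff_sub, sub_eq_zero] at this ⊢
    exact this.symm

theorem HasOrderLE.pow {P : PsiDO} {a : ℤ} (hP : P.HasOrderLE a) (d : ℕ) :
    (P ^ d).HasOrderLE (d * a) := by
  induction d with
  | zero => simpa [one_eq_Dpow_zero] using hasOrderLE_Dpow 0
  | succ d ih =>
    rw [pow_succ, show ((d + 1 : ℕ) : ℤ) * a = d * a + a by push_cast; ring]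
    exact ih.mul hP

namespace IsMonicOfOrderZero

variable {S : PsiDO}

theorem hasOrderLE (hS : S.IsMonicOfOrderZero) : S.HasOrderLE 0 := hS.2

theorem hasOrderLE_one_sub (hS : S.IsMonicOfOrderZero) : (1 - S).HasOrderLE (-1) := fun k hk => by
  rw [one_eq_Dpow_zero, coeff_sub, coeff_Dpow]
  split_ifs with h
  · rw [h, hS.1, sub_self]
  · rw [hS.2 k (by omega), sub_zero]

theorem isUnit (hS : S.IsMonicOfOrderZero) : IsUnit S := by
  set f : ℕ → PsiDO := fun d => ∑ i ∈ Finset.range d, (1 - S) ^ i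
  have hpow (d : ℕ) : ((1 - S) ^ d).HasOrderLE (0 - d) := by
    simpa using hS.hasOrderLE_one_sub.pow d
  obtain ⟨P, hP⟩ := exists_hasOrderLE_sub_of_succ (f := f) (q := 0) fun d => by
    simpa only [f, Finset.sum_range_succ, add_sub_cancel_left] using hpow d
  refine IsUnit.of_mul_eq_one P (eq_of_forall_hasOrderLE_sub fun a => ?_)
  have hgeom : S * f (-a).toNat = 1 - (1 - S) ^ (-a).toNat := by
    simpa only [sub_sub_cancel] using mul_neg_geom_sum (1 - S) (-a).toNat
  have : S * P - 1 = S * (P - f (-a).toNat) - (1 - S) ^ (-a).toNat := by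
    rw [mul_sub, hgeom]
    abel
  rw [this]
  exact ((hS.hasOrderLE.mul (hP _)).mono (by omega)).sub ((hpow _).mono (by omega))

theorem coeff_mul_right (hS : S.IsMonicOfOrderZero) {P : PsiDO} {a : ℤ} (hP : P.HasOrderLE a) :
    (P * S).coeff a = P.coeff a := by
  simpa [hS.1] using coeff_mul_add hP hS.hasOrderLE

theorem coeff_mul_left (hS : S.IsMonicOfOrderZero) {P : PsiDO} {a : ℤ} (hP : P.HasOrderLE a) :
    (S * P).coeff a = P.coeff a := by
  simpa [hS.1] using coeff_mul_add hS.hasOrderLE hP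

theorem hasOrderLE_mul_right_iff (hS : S.IsMonicOfOrderZero) {P : PsiDO} {a : ℤ} :
    (P * S).HasOrderLE a ↔ P.HasOrderLE a := by
  refine ⟨fun h => ?_, fun h => by simpa using h.mul hS.hasOrderLE⟩
  rcases eq_or_ne P 0 with rfl | hP
  · exact hasOrderLE_zero a
  obtain ⟨b, hb, hPb⟩ := exists_top_coeff hP
  rw [← hS.coeff_mul_right hPb] at hb
  exact hPb.mono (not_lt.mp fun hab => hb (h b hab))

theorem hasOrderLE_mul_left_iff (hS : S.IsMonicOfOrderZero) {P : PsiDO} {a : ℤ} :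
    (S * P).HasOrderLE a ↔ P.HasOrderLE a := by
  refine ⟨fun h => ?_, fun h => by simpa using hS.hasOrderLE.mul h⟩
  rcases eq_or_ne P 0 with rfl | hP
  · exact hasOrderLE_zero a
  obtain ⟨b, hb, hPb⟩ := exists_top_coeff hP
  rw [← hS.coeff_mul_left hPb] at hb
  exact hPb.mono (not_lt.mp fun hab => hb (h b hab))

theorem hasOrderLE_iff_of_conj (hS : S.IsMonicOfOrderZero) {M P : PsiDO} (h : M * S = S * P)
    {a : ℤ} : M.HasOrderLE a ↔ P.HasOrderLE a := by
  rw [← hS.hasOrderLE_mul_right_iff, h, hS.hasOrderLE_mul_left_iff]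

theorem coeff_eq_of_conj (hS : S.IsMonicOfOrderZero) {M P : PsiDO} (h : M * S = S * P) {a : ℤ}
    (hP : P.HasOrderLE a) : M.coeff a = P.coeff a := by
  rw [← hS.coeff_mul_right ((hS.hasOrderLE_iff_of_conj h).mpr hP), h, hS.coeff_mul_left hP]

end IsMonicOfOrderZero

/-- The differential operator part `P₊` of `P`. -/
def diffPart (P : PsiDO) : PsiDO where
  coeff k := if 0 ≤ k then P.coeff k else 0
  bdd := by
    obtain ⟨N, hN⟩ := P.bdd
    exact ⟨N, fun k hk => by simp [hN k hk]⟩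

theorem coeff_diffPart_of_neg (P : PsiDO) {k : ℤ} (hk : k < 0) : P.diffPart.coeff k = 0 :=
  if_neg (by omega)

theorem hasOrderLE_sub_diffPart (P : PsiDO) : (P - P.diffPart).HasOrderLE (-1) := fun k hk => by
  exact sub_eq_zero.mpr (if_pos (by omega)).symm

theorem coeff_commutator_D (P : PsiDO) (k : ℤ) :
    (Dpow 1 * P - P * Dpow 1).coeff k = dt (P.coeff k) := by
  rw [coeff_sub, coeff_D_mul, coeff_mul_Dpow, add_sub_cancel_left]

theorem commutator_Dpow {P : PsiDO} {a : ℤ} (hP : (Dpow 1 * P - P * Dpow 1).HasOrderLE a) (n : ℕ) :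
    (Dpow n * P - P * Dpow n).HasOrderLE (n - 1 + a) ∧
      (Dpow n * P - P * Dpow n).coeff (n - 1 + a) = n * dt (P.coeff a) := by
  induction n with
  | zero => simpa [← one_eq_Dpow_zero] using hasOrderLE_zero _
  | succ n ih =>
    have hsplit : Dpow (n + 1 : ℕ) * P - P * Dpow (n + 1 : ℕ) =
        Dpow 1 * (Dpow n * P - P * Dpow n) + (Dpow 1 * P - P * Dpow 1) * Dpow n := by
      rw [Nat.cast_succ, add_comm, ← Dpow_mul_Dpow]
      noncomm_ring
    have horder : ((n + 1 : ℕ) : ℤ) - 1 + a = 1 + (n - 1 + a) := by push_cast; ring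
    have horder' : 1 + (n - 1 + a) = a + n := by ring
    rw [hsplit, horder, coeff_add, coeff_mul_add (hasOrderLE_Dpow 1) ih.1, ih.2, horder',
      coeff_mul_add hP (hasOrderLE_Dpow n), coeff_commutator_D]
    refine ⟨(horder' ▸ (hasOrderLE_Dpow 1).mul ih.1).add (hP.mul (hasOrderLE_Dpow n)), ?_⟩
    simp only [coeff_Dpow, if_true]
    push_cast
    ring

theorem dt_coeff_eq_zero_of_commute {n : ℕ} (hn : n ≠ 0) {P : PsiDO} (h : Commute (Dpow n) P)
    (k : ℤ) : dt (P.coeff k) = 0 := by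
  rw [← coeff_commutator_D]
  suffices Dpow 1 * P - P * Dpow 1 = 0 by rw [this, coeff_zero]
  by_contra hne
  obtain ⟨a, ha, hP⟩ := exists_top_coeff hne
  have htop := (commutator_Dpow hP n).2
  have : CharZero TimeRing := charZero_of_injective_algebraMap (algebraMap ℂ TimeRing).injective
  rw [h.eq, sub_self, coeff_zero, eq_comm, ← coeff_commutator_D] at htop
  exact mul_ne_zero (Nat.cast_ne_zero.mpr hn) ha htop

end PsiDO

/-! ## Wave functions -/

theorem finite_support_laurent_mul {R : Type*} [Semiring R] (x y : LaurentSeries R) (k : ℤ) :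
    (Function.support fun u : ℤ => x.coeff u * y.coeff (k - u)).Finite := by
  refine (Set.finite_Icc x.order (k - y.order)).subset fun u hu => ⟨?_, ?_⟩ <;> by_contra! h
  · exact hu (mul_eq_zero_of_left (HahnSeries.coeff_eq_zero_of_lt_order h) _)
  · exact hu (mul_eq_zero_of_right _ (HahnSeries.coeff_eq_zero_of_lt_order (by omega)))

theorem laurent_coeff_mul {R : Type*} [Semiring R] (x y : LaurentSeries R) (k : ℤ) :
    (x * y).coeff k = ∑ᶠ u, x.coeff u * y.coeff (k - u) := by
  classical
  rw [HahnSeries.coeff_mul]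
  set s := Finset.antidiagonal x.isPWO_support y.isPWO_support k
  rw [finsum_eq_sum_of_support_subset (s := s.image Prod.fst), Finset.sum_image]
  · refine Finset.sum_congr rfl fun p hp => ?_
    rw [← (Finset.mem_antidiagonal.mp hp).2.2, add_sub_cancel_left]
  · intro p hp q hq hpq
    have hp' := (Finset.mem_antidiagonal.mp hp).2.2
    have hq' := (Finset.mem_antidiagonal.mp hq).2.2
    exact Prod.ext hpq (by omega)
  · intro u hu
    refine Finset.mem_coe.mpr (Finset.mem_image.mpr ⟨(u, k - u), ?_, rfl⟩)
    exact Finset.mem_antidiagonal.mpr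
      ⟨left_ne_zero_of_mul hu, right_ne_zero_of_mul hu, by simp⟩

/-- Formal power series in the times, with values in Laurent series in `1 / z`. -/
abbrev WaveRing : Type := MvPowerSeries ℕ+ (LaurentSeries ℂ)

/-- The derivation `∂ / ∂t₁` of the ring of wave functions. -/
def dw : Derivation (LaurentSeries ℂ) WaveRing WaveRing := MvPowerSeries.pderiv _ (1 : ℕ+)

theorem coeff_dw (α : ℕ+ →₀ ℕ) (f : WaveRing) :
    MvPowerSeries.coeff α (dw f) = (α 1 + 1) • MvPowerSeries.coeff (α + Finsupp.single 1 1) f := by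
  rw [dw, MvPowerSeries.coeff_pderiv, nsmul_eq_mul, mul_comm]
  push_cast
  rfl

/-- Series in the times, as wave functions not depending on `z`. -/
def timeToWave : TimeRing →+* WaveRing := MvPowerSeries.map HahnSeries.C

theorem coeff_timeToWave (α : ℕ+ →₀ ℕ) (f : TimeRing) :
    MvPowerSeries.coeff α (timeToWave f) = HahnSeries.C (MvPowerSeries.coeff α f) :=
  MvPowerSeries.coeff_map _ _ _

theorem coeff_timeToWave_mul (α : ℕ+ →₀ ℕ) (f : TimeRing) (F : WaveRing) :
    MvPowerSeries.coeff α (timeToWave f * F) =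
      ∑ p ∈ Finset.HasAntidiagonal.antidiagonal α,
        MvPowerSeries.coeff p.1 f • MvPowerSeries.coeff p.2 F := by
  simp only [MvPowerSeries.coeff_mul, coeff_timeToWave, HahnSeries.C_mul_eq_smul]

namespace PsiDO

/-- The symbol `∑ₖ pₖ zᵏ` of `∑ₖ pₖ Dᵏ`. -/
def symbol : PsiDO →ₛₗ[timeToWave] WaveRing where
  toFun P β := HahnSeries.ofSuppBddBelow (fun l => MvPowerSeries.coeff β (P.coeff (-l))) (by
    obtain ⟨N, hN⟩ := P.bdd
    refine ⟨-N, fun l hl => ?_⟩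
    by_contra h
    exact hl (by simp [hN (-l) (by omega)]))
  map_add' P Q := by
    ext α l
    exact map_add (MvPowerSeries.coeff α) (P.coeff (-l)) (Q.coeff (-l))
  map_smul' c P := by
    ext α l
    refine (MvPowerSeries.coeff_mul α c (P.coeff (-l))).trans (Eq.symm ?_)
    refine (congrArg (fun x : LaurentSeries ℂ => x.coeff l) (coeff_timeToWave_mul α c _)).trans ?_
    exact HahnSeries.coeff_sum _

theorem coeff_symbol (P : PsiDO) (β : ℕ+ →₀ ℕ) (l : ℤ) :
    (MvPowerSeries.coeff β (symbol P)).coeff l = MvPowerSeries.coeff β (P.coeff (-l)) := rfl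

theorem symbol_injective : Function.Injective symbol := fun P Q h => by
  ext k α
  simpa [coeff_symbol] using congrArg (fun f => (MvPowerSeries.coeff α f).coeff (-k)) h

theorem symbol_mul_of_dt_eq_zero (P : PsiDO) {Q : PsiDO} (hQ : ∀ k, dt (Q.coeff k) = 0) :
    symbol (P * Q) = symbol P * symbol Q := by
  ext α l
  have hfin : (Function.support fun i => P.coeff i * Q.coeff (-l - i)).Finite := by
    simpa only [coeff_Dpow_mul_of_dt_eq_zero hQ] using finite_support_coeff_mul P Q (-l)
  have hcoeff (p : (ℕ+ →₀ ℕ) × (ℕ+ →₀ ℕ)) (i : ℤ) :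
      MvPowerSeries.coeff p.1 (P.coeff i) * MvPowerSeries.coeff p.2 (Q.coeff (-l - i)) =
        (MvPowerSeries.coeff p.1 (symbol P)).coeff (Equiv.neg ℤ i) *
          (MvPowerSeries.coeff p.2 (symbol Q)).coeff (l - Equiv.neg ℤ i) := by
    rw [coeff_symbol, coeff_symbol, Equiv.neg_apply, neg_neg, neg_sub', neg_neg]
  rw [coeff_symbol, coeff_mul_of_dt_eq_zero P hQ, map_finsum _ hfin,
    MvPowerSeries.coeff_mul, HahnSeries.coeff_sum]
  simp only [MvPowerSeries.coeff_mul, laurent_coeff_mul]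
  rw [finsum_sum_comm]
  · refine Finset.sum_congr rfl fun p _ => ?_
    rw [finsum_congr (hcoeff p)]
    exact finsum_comp_equiv (Equiv.neg ℤ) (f := fun u =>
      (MvPowerSeries.coeff p.1 (symbol P)).coeff u *
        (MvPowerSeries.coeff p.2 (symbol Q)).coeff (l - u))
  · intro p _
    simp only [hcoeff]
    exact (finite_support_laurent_mul _ _ l).preimage (Equiv.neg ℤ).injective.injOn

theorem symbol_ofLaurent (b : LaurentSeries ℂ) : symbol (ofLaurent b) = MvPowerSeries.C b := by
  classical
  ext α l
  rw [coeff_symbol, coeff_ofLaurent, neg_neg, MvPowerSeries.coeff_C, MvPowerSeries.coeff_C]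
  split_ifs <;> simp

/-- The ring embedding `b(z) ↦ b(D)`. -/
def ofLaurentHom : LaurentSeries ℂ →+* PsiDO where
  toFun := ofLaurent
  map_one' := rfl
  map_zero' := symbol_injective (by simp [symbol_ofLaurent])
  map_add' a b := symbol_injective (by simp [symbol_ofLaurent])
  map_mul' a b := symbol_injective (by
    simp [symbol_mul_of_dt_eq_zero _ (dt_coeff_ofLaurent b), symbol_ofLaurent])

theorem symbol_D_mul (P : PsiDO) :
    symbol (Dpow 1 * P) = dw (symbol P) + MvPowerSeries.C zVar * symbol P := by
  ext α l
  rw [coeff_symbol, coeff_D_mul, map_add, map_add, coeff_dw, MvPowerSeries.coeff_C_mul,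
    HahnSeries.coeff_add', Pi.add_apply, coeff_zVar_mul, coeff_symbol, HahnSeries.coeff_smul,
    coeff_symbol, dt, MvPowerSeries.coeff_pderiv, add_comm, nsmul_eq_mul, mul_comm, neg_add']
  push_cast
  rfl

end PsiDO

/-- The weight `∑ i αᵢ` of the monomial `t ^ α`, i.e. the degree of its `z`-part in `ξ`. -/
def weight : (ℕ+ →₀ ℕ) →+ ℕ := Finsupp.weight fun i : ℕ+ => (i : ℕ)

theorem weight_eq_sum (α : ℕ+ →₀ ℕ) : weight α = α.sum fun i e => (i : ℕ) * e := by
  simp only [weight, Finsupp.weight_apply, smul_eq_mul, mul_comm]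

theorem weight_single_one (k : ℕ) : weight (Finsupp.single 1 k) = k := by
  simp [weight_eq_sum]

theorem weight_eq_zero_iff {α : ℕ+ →₀ ℕ} : weight α = 0 ↔ α = 0 :=
  have := Finsupp.nonTorsionWeight_of ℕ _ fun i : ℕ+ => i.pos.ne'
  Finsupp.weight_eq_zero_iff_eq_zero _

/-- The coefficient `1 / ∏ αᵢ!` of `t ^ α` in `exp (∑ᵢ tᵢ)`. -/
def expCoeff (α : ℕ+ →₀ ℕ) : ℂ := α.prod fun _ e => ((e.factorial : ℂ))⁻¹

theorem expCoeff_add_single (α : ℕ+ →₀ ℕ) :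
    (α 1 + 1 : ℕ) * expCoeff (α + Finsupp.single 1 1) = expCoeff α := by
  rw [expCoeff, expCoeff, ← Finsupp.mul_prod_erase' (α + Finsupp.single 1 1) 1 _ (by simp),
    ← Finsupp.mul_prod_erase' α 1 _ (by simp), Finsupp.erase_add, Finsupp.erase_single, add_zero,
    ← mul_assoc, Finsupp.add_apply, Finsupp.single_eq_same, Nat.factorial_succ, Nat.cast_mul,
    mul_inv, mul_inv_cancel_left₀ (Nat.cast_ne_zero.mpr (Nat.succ_ne_zero _))]

/-- The exponential `exp ξ(t, z)`, where `ξ(t, z) = ∑_{i ≥ 1} tᵢ zⁱ`. -/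
def expXi : WaveRing := fun α => HahnSeries.single (-(weight α : ℤ)) (expCoeff α)

theorem coeff_expXi (α : ℕ+ →₀ ℕ) :
    MvPowerSeries.coeff α expXi = HahnSeries.single (-(weight α : ℤ)) (expCoeff α) := rfl

theorem dw_expXi : dw expXi = MvPowerSeries.C zVar * expXi := by
  ext1 α
  rw [coeff_dw, MvPowerSeries.coeff_C_mul, coeff_expXi, coeff_expXi, zVar,
    HahnSeries.single_mul_single, one_mul, ← expCoeff_add_single α, map_add, weight_single_one,
    Nat.cast_succ, neg_add_rev, ← nsmul_eq_mul]
  exact (map_nsmul (HahnSeries.single.addMonoidHom _) _ _).symm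

namespace PsiDO

/-- The wave function `T exp ξ(t, z)`. -/
def wave : PsiDO →ₛₗ[timeToWave] WaveRing := (LinearMap.mulLeft WaveRing expXi).comp symbol

theorem wave_apply (T : PsiDO) : wave T = expXi * symbol T := rfl

theorem coeff_wave (T : PsiDO) (α : ℕ+ →₀ ℕ) (l : ℤ) :
    (MvPowerSeries.coeff α (wave T)).coeff (-l) = waveCoeff T α l := by
  rw [wave_apply, MvPowerSeries.coeff_mul, HahnSeries.coeff_sum, waveCoeff]
  refine Finset.sum_congr rfl fun p _ => ?_
  rw [coeff_expXi, HahnSeries.coeff_single_mul, coeff_symbol, ← weight_eq_sum, expCoeff]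
  congr 3
  ring

theorem wave_mul_of_dt_eq_zero (P : PsiDO) {Q : PsiDO} (hQ : ∀ k, dt (Q.coeff k) = 0) :
    wave (P * Q) = symbol Q * wave P := by
  rw [wave_apply, symbol_mul_of_dt_eq_zero P hQ, wave_apply]
  ring

theorem wave_mul_ofLaurent (P : PsiDO) (b : LaurentSeries ℂ) :
    wave (P * ofLaurent b) = MvPowerSeries.C b * wave P := by
  rw [wave_mul_of_dt_eq_zero P (dt_coeff_ofLaurent b), symbol_ofLaurent]

theorem wave_D_mul (P : PsiDO) : wave (Dpow 1 * P) = dw (wave P) := by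
  rw [wave_apply, symbol_D_mul, wave_apply, Derivation.leibniz, dw_expXi]
  simp only [smul_eq_mul]
  ring

end PsiDO

theorem waveCoeff_single_of_lt {S : PsiDO} (hS : S.HasOrderLE 0) (k : ℕ) {l : ℤ} (hl : k < l) :
    waveCoeff S (Finsupp.single 1 k) l = 0 := by
  refine Finset.sum_eq_zero fun p hp => ?_
  have hweight := congrArg weight (Finset.HasAntidiagonal.mem_antidiagonal.mp hp)
  rw [map_add, weight_single_one] at hweight
  rw [← weight_eq_sum, hS _ (by omega), map_zero, mul_zero]

theorem waveCoeff_single_self {S : PsiDO} (hS : S.IsMonicOfOrderZero) (k : ℕ) :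
    waveCoeff S (Finsupp.single 1 k) k = ((k.factorial : ℂ))⁻¹ := by
  rw [waveCoeff, Finset.sum_eq_single_of_mem (Finsupp.single 1 k, 0)
    (Finset.HasAntidiagonal.mem_antidiagonal.mpr (add_zero _))]
  · simp [hS.1]
  · intro p hp hne
    have hsum := Finset.HasAntidiagonal.mem_antidiagonal.mp hp
    have hweight := congrArg weight hsum
    have hp2 : weight p.2 ≠ 0 := fun h => hne (by
      rw [weight_eq_zero_iff] at h
      exact Prod.ext (by simpa [h] using hsum) h)
    rw [map_add, weight_single_one] at hweight
    rw [← weight_eq_sum, hS.2 _ (by omega), map_zero, mul_zero]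

/-- The wave functions whose coefficients in the times all lie in `V`. -/
def valuesIn (V : Submodule ℂ (LaurentSeries ℂ)) : AddSubgroup WaveRing where
  carrier := {F | ∀ α, MvPowerSeries.coeff α F ∈ V}
  zero_mem' := by simp
  add_mem' hF hG α := by simpa using V.add_mem (hF α) (hG α)
  neg_mem' hF α := by simpa using hF α

/-- The ring `{b | b V ⊆ V}` of the scalars that preserve `V`. -/
def multipliers (V : Submodule ℂ (LaurentSeries ℂ)) : Subring (LaurentSeries ℂ) where
  carrier := {b | ∀ x ∈ V, b * x ∈ V}
  mul_mem' ha hb x hx := by simpa only [mul_assoc] using ha _ (hb x hx)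
  one_mem' x hx := by rwa [one_mul]
  add_mem' ha hb x hx := by simpa only [add_mul] using V.add_mem (ha x hx) (hb x hx)
  zero_mem' x _ := by simp
  neg_mem' ha x hx := neg_mul _ x ▸ V.neg_mem (ha x hx)

section ValuesIn

variable {V : Submodule ℂ (LaurentSeries ℂ)} {F : WaveRing}

theorem timeToWave_mul_mem_valuesIn (f : TimeRing) (hF : F ∈ valuesIn V) :
    timeToWave f * F ∈ valuesIn V := fun α => by
  rw [coeff_timeToWave_mul]
  exact V.sum_mem fun p _ => V.smul_mem _ (hF _)

theorem dw_mem_valuesIn (hF : F ∈ valuesIn V) : dw F ∈ valuesIn V := fun α => by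
  rw [coeff_dw]
  exact V.nsmul_mem (hF _) _

theorem C_mul_mem_valuesIn {b : LaurentSeries ℂ} (hb : b ∈ multipliers V) (hF : F ∈ valuesIn V) :
    MvPowerSeries.C b * F ∈ valuesIn V := fun α => by
  rw [MvPowerSeries.coeff_C_mul]
  exact hb _ (hF α)

theorem wave_mul_mem_valuesIn {M S : PsiDO} (hM : ∀ k < 0, M.coeff k = 0)
    (hS : PsiDO.wave S ∈ valuesIn V) : PsiDO.wave (M * S) ∈ valuesIn V := by
  have hpow (i : ℕ) : PsiDO.wave (PsiDO.Dpow i * S) ∈ valuesIn V := by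
    induction i with
    | zero => rwa [Nat.cast_zero, PsiDO.Dpow_zero_mul]
    | succ i ih =>
      rw [Nat.cast_succ, add_comm, ← PsiDO.D_mul_Dpow_mul, PsiDO.wave_D_mul]
      exact dw_mem_valuesIn ih
  obtain ⟨N, hN⟩ := M.exists_hasOrderLE
  have hsupp : ∀ k ∉ Finset.Icc 0 N, M.coeff k = 0 := fun k hk => by
    rw [Finset.mem_Icc, not_and_or, not_le, not_le] at hk
    exact hk.elim (hM k) (hN k)
  rw [PsiDO.eq_sum_Dpow hsupp, Finset.sum_mul, map_sum]
  refine sum_mem fun i hi => ?_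
  obtain ⟨i, rfl⟩ := Int.eq_ofNat_of_zero_le (Finset.mem_Icc.mp hi).1
  rw [smul_mul_assoc, map_smulₛₗ]
  exact timeToWave_mul_mem_valuesIn _ (hpow i)

end ValuesIn

/-! ## Laurent series in `1 / z` -/

/-- A Laurent series has degree `N` if its leading term is a multiple of `z ^ N`; as the variable of
`LaurentSeries` is `1 / z`, degrees are negated orders. The zero series has no degree. -/
def HasDeg {R : Type*} [Zero R] (x : HahnSeries ℤ R) (N : ℤ) : Prop :=
  x.coeff (-N) ≠ 0 ∧ ∀ l < -N, x.coeff l = 0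

section HasDeg

variable {R : Type*}

theorem HasDeg.ne_zero [Zero R] {x : HahnSeries ℤ R} {N : ℤ} (h : HasDeg x N) : x ≠ 0 :=
  HahnSeries.ne_zero_of_coeff_ne_zero h.1

theorem hasDeg_iff [Zero R] {x : HahnSeries ℤ R} {N : ℤ} : HasDeg x N ↔ x ≠ 0 ∧ x.order = -N := by
  refine ⟨fun h => ⟨h.ne_zero, ?_⟩, fun ⟨hx, h⟩ => ⟨?_, fun l hl => ?_⟩⟩
  · exact (HahnSeries.order_le_of_coeff_ne_zero h.1).antisymm
      ((HahnSeries.le_order_iff_forall h.ne_zero).mpr h.2)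
  · rwa [← h, Ne, HahnSeries.coeff_order_eq_zero]
  · exact HahnSeries.coeff_eq_zero_of_lt_order (h ▸ hl)

theorem exists_hasDeg [Zero R] {x : HahnSeries ℤ R} (hx : x ≠ 0) : ∃ N, HasDeg x N :=
  ⟨-x.order, hasDeg_iff.mpr ⟨hx, (neg_neg _).symm⟩⟩

theorem HasDeg.unique [Zero R] {x : HahnSeries ℤ R} {N M : ℤ} (h : HasDeg x N) (h' : HasDeg x M) :
    N = M :=
  neg_injective ((hasDeg_iff.mp h).2.symm.trans (hasDeg_iff.mp h').2)

theorem HasDeg.mul [NonUnitalNonAssocSemiring R] [NoZeroDivisors R] {x y : HahnSeries ℤ R}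
    {N M : ℤ} (hx : HasDeg x N) (hy : HasDeg y M) : HasDeg (x * y) (N + M) := by
  rw [hasDeg_iff] at hx hy ⊢
  exact ⟨mul_ne_zero hx.1 hy.1, by rw [HahnSeries.order_mul hx.1 hy.1, hx.2, hy.2, neg_add]⟩

theorem HasDeg.pow [Semiring R] [NoZeroDivisors R] {x : HahnSeries ℤ R} {N : ℤ} (hx : HasDeg x N)
    (k : ℕ) : HasDeg (x ^ k) (k * N) := by
  rw [hasDeg_iff] at hx ⊢
  exact ⟨pow_ne_zero k hx.1, by rw [HahnSeries.order_pow, hx.2, nsmul_eq_mul, mul_neg]⟩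

theorem hasDeg_single [Zero R] {N : ℤ} {r : R} (hr : r ≠ 0) :
    HasDeg (HahnSeries.single (-N) r) N :=
  hasDeg_iff.mpr ⟨HahnSeries.single_ne_zero hr, HahnSeries.order_single hr⟩

theorem eq_zero_of_sum_eq_zero [AddCommMonoid R] {ι : Type*} {s : Finset ι}
    {f : ι → HahnSeries ℤ R} {N : ι → ℤ} (hN : Set.InjOn N s)
    (hf : ∀ i ∈ s, f i ≠ 0 → HasDeg (f i) (N i)) (h : ∑ i ∈ s, f i = 0) :
    ∀ i ∈ s, f i = 0 := by
  classical
  by_contra! hne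
  obtain ⟨i, hi, hmax⟩ := (s.filter fun i => f i ≠ 0).exists_max_image N
    (hne.imp fun i hi => Finset.mem_filter.mpr hi)
  obtain ⟨his, hi0⟩ := Finset.mem_filter.mp hi
  apply (hf i his hi0).1
  rw [← Finset.sum_eq_single (f := fun j => (f j).coeff (-N i)) i, ← HahnSeries.coeff_sum, h,
    HahnSeries.coeff_zero]
  · intro j hj hji
    by_cases hj0 : f j = 0
    · rw [hj0, HahnSeries.coeff_zero]
    · have hle := hmax j (Finset.mem_filter.mpr ⟨hj, hj0⟩)
      have hlt := hle.lt_of_ne (hN.ne hj his hji)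
      exact (hf j hj hj0).2 _ (neg_lt_neg hlt)
  · exact fun hi => absurd his hi

end HasDeg

/-- A polynomial in `z`, as a Laurent series in `1 / z`. -/
def ofPoly : ℂ[X] →ₐ[ℂ] LaurentSeries ℂ := aeval zVar

theorem ofPoly_monomial (k : ℕ) (c : ℂ) :
    ofPoly (monomial k c) = HahnSeries.single (-(k : ℤ)) c := by
  rw [ofPoly, aeval_monomial, zVar, HahnSeries.single_pow, one_pow, nsmul_eq_mul, mul_neg, mul_one,
    show algebraMap ℂ (LaurentSeries ℂ) c = HahnSeries.C c from HahnSeries.ofPowerSeries_C c,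
    HahnSeries.C_apply, HahnSeries.single_mul_single, zero_add, mul_one]

theorem coeff_ofPoly (p : ℂ[X]) (k : ℕ) : (ofPoly p).coeff (-k) = p.coeff k := by
  induction p using Polynomial.induction_on' with
  | add p q hp hq => rw [map_add, HahnSeries.coeff_add, hp, hq, coeff_add]
  | monomial j c => simp [ofPoly_monomial, HahnSeries.coeff_single, coeff_monomial, eq_comm]

theorem coeff_ofPoly_of_pos (p : ℂ[X]) {l : ℤ} (hl : 0 < l) : (ofPoly p).coeff l = 0 := by
  induction p using Polynomial.induction_on' with
  | add p q hp hq => rw [map_add, HahnSeries.coeff_add, hp, hq, add_zero]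
  | monomial j c => rw [ofPoly_monomial, HahnSeries.coeff_single_of_ne (by omega)]

theorem ofPoly_injective : Function.Injective ofPoly := fun p q h => by
  ext k
  rw [← coeff_ofPoly, h, coeff_ofPoly]

theorem exists_ofPoly_eq {x : LaurentSeries ℂ} (hx : ∀ l, 0 < l → x.coeff l = 0) :
    ∃ p, ofPoly p = x := by
  have hfin : (Function.support fun k : ℕ => x.coeff (-k)).Finite :=
    (Set.finite_Iic (-x.order).toNat).subset fun k hk => by
      have := HahnSeries.order_le_of_coeff_ne_zero hk
      rw [Set.mem_Iic]
      omega
  refine ⟨⟨.ofCoeff (Finsupp.ofSupportFinite _ hfin)⟩, HahnSeries.ext (funext fun l => ?_)⟩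
  rcases lt_or_ge 0 l with hl | hl
  · rw [coeff_ofPoly_of_pos _ hl, hx l hl]
  · obtain ⟨k, rfl⟩ : ∃ k : ℕ, l = -k := ⟨(-l).toNat, by omega⟩
    rw [coeff_ofPoly]
    rfl

theorem hasDeg_ofPoly {p : ℂ[X]} (hp : p ≠ 0) : HasDeg (ofPoly p) p.natDegree := by
  refine ⟨by rwa [coeff_ofPoly, coeff_natDegree, leadingCoeff_ne_zero], fun l hl => ?_⟩
  obtain ⟨k, rfl⟩ : ∃ k : ℕ, l = -k := ⟨(-l).toNat, by omega⟩
  rw [coeff_ofPoly, coeff_eq_zero_of_natDegree_lt (by omega)]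

/-- The substitution `f(z) ↦ f(zⁿ)`. -/
def substPow (n : ℕ) [NeZero n] : LaurentSeries ℂ →+* LaurentSeries ℂ :=
  HahnSeries.embDomainRingHom (AddMonoidHom.mulLeft (n : ℤ))
    (mul_right_injective₀ (NeZero.ne (n : ℤ)))
    fun _ _ => mul_le_mul_iff_right₀ (Nat.cast_pos.mpr (NeZero.pos n))

theorem coeff_substPow (n : ℕ) [NeZero n] (f : LaurentSeries ℂ) (q : ℤ) :
    (substPow n f).coeff (n * q) = f.coeff q :=
  HahnSeries.embDomain_coeff (a := q)

theorem coeff_substPow_of_not_dvd {n : ℕ} [NeZero n] (f : LaurentSeries ℂ) {l : ℤ}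
    (hl : ¬ (n : ℤ) ∣ l) : (substPow n f).coeff l = 0 :=
  HahnSeries.embDomain_of_notMem_range fun ⟨q, hq⟩ => hl ⟨q, hq.symm⟩

theorem substPow_single (n : ℕ) [NeZero n] (k : ℤ) (c : ℂ) :
    substPow n (HahnSeries.single k c) = HahnSeries.single (n * k) c :=
  HahnSeries.embDomain_single

theorem HasDeg.substPow {f : LaurentSeries ℂ} {N : ℤ} (n : ℕ) [NeZero n] (hf : HasDeg f N) :
    HasDeg (substPow n f) (n * N) := by
  refine ⟨by rw [← mul_neg, coeff_substPow]; exact hf.1, fun l hl => ?_⟩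
  by_cases hdvd : (n : ℤ) ∣ l
  · obtain ⟨q, rfl⟩ := hdvd
    rw [coeff_substPow]
    rw [← mul_neg] at hl
    exact hf.2 q (lt_of_mul_lt_mul_of_nonneg_left hl (Nat.cast_nonneg n))
  · exact coeff_substPow_of_not_dvd f hdvd

theorem finsum_int_eq_sum_finsum {M : Type*} [AddCommMonoid M] (n : ℕ) [NeZero n] {f : ℤ → M}
    (hf : (Function.support f).Finite) :
    ∑ᶠ u, f u = ∑ j : Fin n, ∑ᶠ r : ℤ, f (n * r + (j : ℕ)) := by
  let e : Fin n × ℤ ≃ ℤ := (Equiv.prodComm _ _).trans (Int.divModEquiv n).symm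
  have hfe : (Function.support (f ∘ e)).Finite := hf.preimage e.injective.injOn
  rw [← finsum_comp_equiv e]
  refine (finsum_curry (f ∘ e) hfe).trans ?_
  rw [finsum_eq_sum_of_fintype]
  simp [e, mul_comm]

section EvalLam

variable {n : ℕ}

theorem evalLam_mul (b c : LaurentSeries ℂ) :
    evalLam (n := n) (b * c) = evalLam b * evalLam c := by
  ext i k q
  have : NeZero n := ⟨i.pos.ne'⟩
  have hfin := (finite_support_laurent_mul b c (n * q - (i : ℕ) + (k : ℕ))).preimage
    (Equiv.subRight ((i : ℕ) : ℤ)).injective.injOn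
  rw [evalLam_coeff, laurent_coeff_mul, ← finsum_comp_equiv (Equiv.subRight ((i : ℕ) : ℤ)),
    finsum_int_eq_sum_finsum n hfin, Matrix.mul_apply, HahnSeries.coeff_sum]
  refine Finset.sum_congr rfl fun j _ => ?_
  rw [laurent_coeff_mul]
  refine finsum_congr fun r => ?_
  rw [evalLam_coeff, evalLam_coeff, Equiv.subRight_apply]
  congrm b.coeff ?_ * c.coeff ?_ <;> ring

theorem evalLam_substPow [NeZero n] (f : LaurentSeries ℂ) :
    evalLam (substPow n f) = Matrix.scalar (Fin n) f := by
  ext i j q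
  rw [evalLam_coeff, Matrix.scalar_apply, Matrix.diagonal_apply]
  split_ifs with hij
  · rw [hij, sub_add_cancel, coeff_substPow]
  · refine coeff_substPow_of_not_dvd f fun hdvd => hij (Fin.ext ?_)
    have hdvd' : (n : ℤ) ∣ (j : ℕ) - (i : ℕ) := by
      simpa [sub_add_eq_add_sub, add_sub_assoc] using hdvd
    exact Nat.ModEq.eq_of_lt_of_lt ((Nat.modEq_iff_dvd).mpr hdvd') i.isLt j.isLt

/-- The ring homomorphism `b ↦ b(Λ)`. -/
def evalLamHom (n : ℕ) : LaurentSeries ℂ →+* Matrix (Fin n) (Fin n) (LaurentSeries ℂ) where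
  toFun := evalLam
  map_one' := evalLam_one
  map_mul' := evalLam_mul
  map_zero' := by ext; simp [evalLam_coeff]
  map_add' b c := by ext; simp [evalLam_coeff]

theorem evalLamHom_apply (b : LaurentSeries ℂ) : evalLamHom n b = evalLam b := rfl

end EvalLam

/-! ## The identification `Ξ` and the spaces `Ξ(Γ ℂ[z]ⁿ)` -/

section Split

variable {n : ℕ} [NeZero n]

variable (n) in
/-- The pairs `(q, i)` index the monomials `z ^ q` in the slot `i` of a vector of Laurent series in
`1 / z`; `Ξ` maps this monomial to `z ^ (n q + i)`. Both sides are indexed by exponents of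
`1 / z`. -/
def indexEquiv : ℤ × Fin n ≃ ℤ :=
  (((Equiv.neg ℤ).prodCongr (Equiv.refl _)).trans (Int.divModEquiv n).symm).trans (Equiv.neg ℤ)

theorem indexEquiv_apply (q : ℤ) (i : Fin n) : indexEquiv n (q, i) = n * q - (i : ℕ) := by
  simp [indexEquiv]
  ring

theorem exists_eq_mul_sub (n : ℕ) [NeZero n] (l : ℤ) :
    ∃ (q : ℤ) (i : Fin n), l = n * q - (i : ℕ) := by
  obtain ⟨⟨q, i⟩, rfl⟩ := (indexEquiv n).surjective l
  exact ⟨q, i, indexEquiv_apply q i⟩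

theorem bddBelow_support_indexEquiv_symm (v : Fin n → LaurentSeries ℂ) :
    BddBelow (Function.support fun l : ℤ =>
      (v ((indexEquiv n).symm l).2).coeff ((indexEquiv n).symm l).1) := by
  obtain ⟨A, hA⟩ := (Set.finite_range fun i => (v i).order).bddBelow
  refine ⟨n * A - n, fun l hl => ?_⟩
  obtain ⟨⟨q, i⟩, rfl⟩ := (indexEquiv n).surjective l
  rw [Function.mem_support, Equiv.symm_apply_apply] at hl
  have hq : A ≤ q := (hA ⟨i, rfl⟩).trans (HahnSeries.order_le_of_coeff_ne_zero hl)
  have := mul_le_mul_of_nonneg_left hq (Nat.cast_nonneg (α := ℤ) n)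
  rw [indexEquiv_apply]
  omega

variable (n) in
/-- The inverse of `Ξ` on Laurent series: `x = ∑ᵢ zⁱ fᵢ(zⁿ)` with `f = split n x`. -/
def split : LaurentSeries ℂ ≃+ (Fin n → LaurentSeries ℂ) where
  toFun x i := evalLam x i 0
  invFun v := HahnSeries.ofSuppBddBelow _ (bddBelow_support_indexEquiv_symm v)
  left_inv x := by
    ext l
    obtain ⟨⟨q, i⟩, rfl⟩ := (indexEquiv n).surjective l
    change (evalLam x ((indexEquiv n).symm _).2 0).coeff ((indexEquiv n).symm _).1 = _
    rw [Equiv.symm_apply_apply, evalLam_coeff, indexEquiv_apply, Fin.val_zero, Nat.cast_zero,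
      add_zero]
  right_inv v := by
    ext i q
    simp [evalLam_coeff, ← indexEquiv_apply]
  map_add' x y := by
    ext i q
    simp [evalLam_coeff]

theorem coeff_split (x : LaurentSeries ℂ) (i : Fin n) (q : ℤ) :
    (split n x i).coeff q = x.coeff (n * q - (i : ℕ)) := by
  change (evalLam x i 0).coeff q = _
  simp [evalLam_coeff]

theorem split_mul (b x : LaurentSeries ℂ) : split n (b * x) = (evalLam b).mulVec (split n x) := by
  ext1 i
  change evalLam (b * x) i 0 = _
  rw [evalLam_mul]
  rfl

theorem split_substPow_mul (f x : LaurentSeries ℂ) :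
    split n (substPow n f * x) = f • split n x := by
  rw [split_mul, evalLam_substPow, Matrix.scalar_apply]
  ext1 i
  rw [Matrix.mulVec_diagonal]
  rfl

theorem split_single (j : Fin n) :
    split n (HahnSeries.single (-((j : ℕ) : ℤ)) 1) = Pi.single j 1 := by
  ext i q
  rw [coeff_split, HahnSeries.coeff_single]
  by_cases hij : i = j
  · subst hij
    simp [HahnSeries.coeff_one, NeZero.ne n]
  · rw [Pi.single_eq_of_ne hij, HahnSeries.coeff_zero, if_neg]
    intro h
    refine hij (congrArg Prod.snd ((indexEquiv n).injective (a₁ := (q, i)) (a₂ := (0, j)) ?_))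
    rw [indexEquiv_apply, indexEquiv_apply, h, mul_zero, zero_sub]

theorem substPow_C_mul (c : ℂ) (x : LaurentSeries ℂ) : substPow n (HahnSeries.C c) * x = c • x := by
  rw [HahnSeries.C_apply, substPow_single, mul_zero]
  exact HahnSeries.C_mul_eq_smul

/-- The endomorphism of the space of Laurent series that corresponds to `Γ` under `Ξ`. -/
def act (Γ : Matrix (Fin n) (Fin n) (LaurentSeries ℂ)) : LaurentSeries ℂ →ₗ[ℂ] LaurentSeries ℂ where
  toFun x := (split n).symm (Γ.mulVec (split n x))
  map_add' x y := by rw [map_add, Matrix.mulVec_add, map_add]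
  map_smul' c x := by
    rw [RingHom.id_apply, ← substPow_C_mul (n := n), split_substPow_mul, Matrix.mulVec_smul,
      ← substPow_C_mul (n := n), AddEquiv.symm_apply_eq, split_substPow_mul,
      AddEquiv.apply_symm_apply]

variable {Γ : Matrix (Fin n) (Fin n) (LaurentSeries ℂ)}

theorem split_act (x : LaurentSeries ℂ) : split n (act Γ x) = Γ.mulVec (split n x) :=
  (split n).apply_symm_apply _

theorem act_mul (Γ Δ : Matrix (Fin n) (Fin n) (LaurentSeries ℂ)) (x : LaurentSeries ℂ) :
    act (Γ * Δ) x = act Γ (act Δ x) :=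
  (split n).injective (by simp only [split_act, Matrix.mulVec_mulVec])

theorem act_one (x : LaurentSeries ℂ) : act (n := n) 1 x = x :=
  (split n).injective (by rw [split_act, Matrix.one_mulVec])

theorem act_evalLam (b x : LaurentSeries ℂ) : act (n := n) (evalLam b) x = b * x :=
  (split n).injective (by rw [split_act, split_mul])

theorem act_substPow_mul (f x : LaurentSeries ℂ) :
    act Γ (substPow n f * x) = substPow n f * act Γ x :=
  (split n).injective (by simp only [split_act, split_substPow_mul, Matrix.mulVec_smul])

theorem coeff_act (x : LaurentSeries ℂ) (q : ℤ) (i : Fin n) :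
    (act Γ x).coeff (n * q - (i : ℕ)) =
      ∑ j, ∑ᶠ r, (Γ i j).coeff r * x.coeff (n * (q - r) - (j : ℕ)) := by
  rw [← coeff_split, split_act, Matrix.mulVec, dotProduct, HahnSeries.coeff_sum]
  simp only [laurent_coeff_mul, coeff_split]

theorem coeff_act_single (i j : Fin n) (q : ℤ) :
    (act Γ (HahnSeries.single (-((j : ℕ) : ℤ)) 1)).coeff (n * q - (i : ℕ)) = (Γ i j).coeff q := by
  rw [← coeff_split, split_act, split_single, Matrix.mulVec_single_one, Matrix.col_apply]

/-- The polynomials in `z`, as a space of Laurent series in `1 / z`. -/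
def polys : Submodule ℂ (LaurentSeries ℂ) where
  carrier := {x | ∀ l, 0 < l → x.coeff l = 0}
  zero_mem' _ _ := HahnSeries.coeff_zero
  add_mem' hx hy l hl := by rw [HahnSeries.coeff_add, hx l hl, hy l hl, add_zero]
  smul_mem' c x hx l hl := by rw [HahnSeries.coeff_smul, hx l hl, smul_zero]

theorem exists_ofPoly_eq_split {x : LaurentSeries ℂ} (hx : x ∈ polys) :
    ∃ p : Fin n → ℂ[X], ∀ i, ofPoly (p i) = split n x i := by
  choose p hp using fun i => exists_ofPoly_eq (x := split n x i) fun q hq => by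
    rw [coeff_split]
    exact hx _ (by have := i.isLt; nlinarith)
  exact ⟨p, hp⟩

/-- The image in `ℂ((1/z))` of `Γ ℂ[z]ⁿ` under `Ξ`. -/
def polySpace (Γ : Matrix (Fin n) (Fin n) (LaurentSeries ℂ)) : Submodule ℂ (LaurentSeries ℂ) :=
  polys.map (act Γ)

/-- An upper unitriangular constant matrix plus `O(1 / z)`. -/
structure IsUnipotentAtInfty (Γ : Matrix (Fin n) (Fin n) (LaurentSeries ℂ)) : Prop where
  neg : ∀ i j, ∀ r < 0, (Γ i j).coeff r = 0
  diag : ∀ i, (Γ i i).coeff 0 = 1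
  lower : ∀ i j, j < i → (Γ i j).coeff 0 = 0

namespace IsUnipotentAtInfty

theorem coeff_act_of_le (hΓ : IsUnipotentAtInfty Γ) {x : LaurentSeries ℂ} {N : ℤ}
    (hx : ∀ l < N, x.coeff l = 0) {l : ℤ} (hl : l ≤ N) : (act Γ x).coeff l = x.coeff l := by
  obtain ⟨q, i, rfl⟩ := exists_eq_mul_sub n l
  have hterm (j : Fin n) (r : ℤ) (hjr : j ≠ i ∨ r ≠ 0) :
      (Γ i j).coeff r * x.coeff (n * (q - r) - (j : ℕ)) = 0 := by
    rcases lt_trichotomy r 0 with hr | rfl | hr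
    · rw [hΓ.neg i j r hr, zero_mul]
    · rcases lt_or_gt_of_ne (hjr.resolve_right (not_not.mpr rfl)) with hj | hj
      · rw [hΓ.lower i j hj, zero_mul]
      · rw [sub_zero, hx, mul_zero]
        have : (i : ℕ) < j := hj
        omega
    · rw [hx, mul_zero]
      have := i.isLt
      nlinarith
  rw [coeff_act, Finset.sum_eq_single i, finsum_eq_single _ 0, hΓ.diag, one_mul, sub_zero]
  · exact fun r hr => hterm i r (.inr hr)
  · exact fun j _ hj => finsum_eq_zero_of_forall_eq_zero fun r => hterm j r (.inl hj)
  · simp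

theorem hasDeg_act (hΓ : IsUnipotentAtInfty Γ) {x : LaurentSeries ℂ} {N : ℤ} (hx : HasDeg x N) :
    HasDeg (act Γ x) N :=
  ⟨by rw [hΓ.coeff_act_of_le hx.2 le_rfl]; exact hx.1,
    fun l hl => by rw [hΓ.coeff_act_of_le hx.2 hl.le, hx.2 l hl]⟩

theorem act_injective (hΓ : IsUnipotentAtInfty Γ) : Function.Injective (act Γ) := by
  refine (injective_iff_map_eq_zero _).mpr fun x hx => ?_
  by_contra hx0
  obtain ⟨N, hN⟩ := exists_hasDeg hx0
  exact (hΓ.hasDeg_act hN).ne_zero hx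

theorem isUnit_det (hΓ : IsUnipotentAtInfty Γ) : IsUnit Γ.det := by
  rw [← Matrix.isUnit_iff_isUnit_det, ← Matrix.mulVec_injective_iff_isUnit]
  have : Γ.mulVec = split n ∘ act Γ ∘ (split n).symm := funext fun v => by
    simp only [Function.comp_apply, split_act, AddEquiv.apply_symm_apply]
  rw [this]
  exact (split n).injective.comp (hΓ.act_injective.comp (split n).symm.injective)

theorem exists_mem_polySpace_sub (hΓ : IsUnipotentAtInfty Γ) (x : LaurentSeries ℂ) :
    ∃ y ∈ polySpace Γ, ∀ l ≤ 0, (x - y).coeff l = 0 := by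
  set x' := act Γ⁻¹ x
  have hx : act Γ x' = x := by
    rw [← act_mul, Matrix.mul_nonsing_inv _ hΓ.isUnit_det, act_one]
  refine ⟨act Γ (HahnSeries.truncLT 1 x'), ⟨_, fun l hl => ?_, rfl⟩, fun l hl => ?_⟩
  · exact HahnSeries.coeff_truncLT_of_le (by omega) x'
  · have hr : ∀ l < 1, (x' - HahnSeries.truncLT 1 x').coeff l = 0 := fun l hl => by
      rw [HahnSeries.coeff_sub, HahnSeries.coeff_truncLT_of_lt hl, sub_self]
    rw [← hx, ← map_sub, hΓ.coeff_act_of_le hr (by omega), hr l (by omega)]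

theorem eq_zero_of_mem_polySpace (hΓ : IsUnipotentAtInfty Γ) {x : LaurentSeries ℂ}
    (hx : x ∈ polySpace Γ) (h : ∀ l ≤ 0, x.coeff l = 0) : x = 0 := by
  obtain ⟨y, hy, rfl⟩ := hx
  by_contra hne
  obtain ⟨N, hN⟩ := exists_hasDeg (x := y) (by rintro rfl; exact hne (map_zero _))
  rcases lt_or_ge 0 (-N) with hpos | hpos
  · exact hN.1 (hy _ hpos)
  · exact (hΓ.hasDeg_act hN).1 (h _ hpos)

end IsUnipotentAtInfty

end Split

/-! ## Fourier series -/

/-- The Laurent series `x` in `1 / z` is the Fourier series of the square integrable function `g`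
on the circle. -/
structure HasFourierSeries (g : UnitAddCircle → ℂ) (x : LaurentSeries ℂ) : Prop where
  memLp : MemLp g 2 haarAddCircle
  coeff : ∀ k, fourierCoeff g k = x.coeff (-k)

namespace HasFourierSeries

variable {g h : UnitAddCircle → ℂ} {x y : LaurentSeries ℂ}

theorem integrable (hg : HasFourierSeries g x) : Integrable g haarAddCircle :=
  hg.memLp.integrable one_le_two

theorem one : HasFourierSeries (fun _ => 1) 1 where
  memLp := memLp_const 1
  coeff k := by
    have h : (fun _ : UnitAddCircle => (1 : ℂ)) = fourier 0 := funext fun _ => fourier_zero.symm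
    rw [h, fourierCoeff_fourier, HahnSeries.coeff_one, Pi.single_apply]
    simp only [neg_eq_zero]

theorem add (hg : HasFourierSeries g x) (hh : HasFourierSeries h y) :
    HasFourierSeries (fun t => g t + h t) (x + y) where
  memLp := hg.memLp.add hh.memLp
  coeff k := by
    rw [HahnSeries.coeff_add, ← hg.coeff, ← hh.coeff]
    exact congrFun (fourierCoeff.add hg.integrable hh.integrable) k

theorem sum {ι : Type*} {s : Finset ι} {g : ι → UnitAddCircle → ℂ} {x : ι → LaurentSeries ℂ}
    (hg : ∀ i, HasFourierSeries (g i) (x i)) :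
    HasFourierSeries (fun t => ∑ i ∈ s, g i t) (∑ i ∈ s, x i) where
  memLp := memLp_finsetSum _ fun i _ => (hg i).memLp
  coeff k := by
    rw [HahnSeries.coeff_sum, ← Finset.sum_fn, fourierCoeff.sum _ _ fun i _ => (hg i).integrable,
      Finset.sum_apply]
    exact Finset.sum_congr rfl fun i _ => (hg i).coeff k

theorem const_mul (c : ℂ) (hg : HasFourierSeries g x) :
    HasFourierSeries (fun t => c * g t) (c • x) where
  memLp := hg.memLp.const_mul c
  coeff k := by rw [fourierCoeff.const_mul, hg.coeff, HahnSeries.coeff_smul, smul_eq_mul]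

theorem fourier_one_mul (hg : HasFourierSeries g x) :
    HasFourierSeries (fun t => fourier 1 t * g t) (zVar * x) where
  memLp := hg.memLp.of_le
    ((fourier 1).continuous.aestronglyMeasurable.mul hg.memLp.aestronglyMeasurable)
    (ae_of_all _ fun t => by rw [norm_mul, fourier_apply, Circle.norm_coe, one_mul])
  coeff k := by
    rw [coeff_zVar_mul, ← sub_eq_neg_add, ← neg_sub, ← hg.coeff, fourierCoeff, fourierCoeff]
    refine integral_congr_ae (ae_of_all _ fun t => ?_)
    dsimp only
    rw [neg_sub, sub_eq_neg_add, fourier_add, smul_eq_mul, smul_eq_mul, mul_assoc]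

theorem polynomial_eval_mul (hg : HasFourierSeries g x) (p : ℂ[X]) :
    HasFourierSeries (fun t => p.eval (fourier 1 t) * g t) (ofPoly p * x) := by
  induction p using Polynomial.induction_on with
  | C a =>
    convert hg.const_mul a using 1
    · simp only [eval_C]
    · rw [← monomial_zero_left, ofPoly_monomial, Nat.cast_zero, neg_zero, ← HahnSeries.C_apply,
        HahnSeries.C_mul_eq_smul]
  | add p q hp hq =>
    convert hp.add hq using 1
    · simp only [eval_add, add_mul]
    · rw [map_add, add_mul]
  | monomial k a ih =>
    convert ih.fourier_one_mul using 1
    · funext t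
      simp only [eval_mul, eval_C, eval_pow, eval_X]
      ring
    · simp only [pow_succ', map_mul, ofPoly, aeval_X]
      ring

end HasFourierSeries

section LoopSpace

variable {n : ℕ} {γ : MatLoop n}

theorem IsHalfLoop.memLp (hγ : IsHalfLoop γ) (i j : Fin n) :
    MemLp (fun t => γ t i j) 2 haarAddCircle := by
  obtain ⟨K, hK⟩ := hγ.bdd
  exact MemLp.of_bound (hγ.meas i j) K (hK.mono fun t ht => ht i j)

theorem IsNormalized.coeff_loopSeries (hnorm : IsNormalized γ) (i j : Fin n) (r : ℤ) :
    (loopSeries γ i j).coeff r = loopCoeff γ (-r) i j := by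
  rw [loopSeries, Matrix.of_apply, PowerSeries.coeff_coe]
  split_ifs with h
  · rw [hnorm.pos _ (by omega), Matrix.zero_apply]
  · rw [PowerSeries.coeff_mk, Int.natAbs_of_nonneg (not_lt.mp h)]

theorem IsNormalized.hasFourierSeries (hnorm : IsNormalized γ)
    (hγ : ∀ i j, MemLp (fun t => γ t i j) 2 haarAddCircle) (i j : Fin n) :
    HasFourierSeries (fun t => γ t i j) (loopSeries γ i j) where
  memLp := hγ i j
  coeff k := by rw [hnorm.coeff_loopSeries, neg_neg]; rfl

theorem IsNormalized.isUnipotentAtInfty (hnorm : IsNormalized γ) :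
    IsUnipotentAtInfty (loopSeries γ) where
  neg i j r hr := by rw [hnorm.coeff_loopSeries, hnorm.pos _ (by omega), Matrix.zero_apply]
  diag i := by rw [hnorm.coeff_loopSeries, neg_zero, hnorm.diag]
  lower i j h := by rw [hnorm.coeff_loopSeries, neg_zero, hnorm.lower i j h]

theorem exists_Hn_of_hasFourierSeries [NeZero n] {F : Fin n → UnitAddCircle → ℂ}
    {x : LaurentSeries ℂ} (hF : ∀ i, HasFourierSeries (F i) (split n x i)) :
    ∃ f : Hn n, (∀ᵐ t ∂haarAddCircle, ∀ i, f t i = F i t) ∧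
      ∀ (i : Fin n) (k : ℤ), vecCoeff f i k = x.coeff (-(n * k + (i : ℕ))) := by
  have hmem : MemLp (fun t => (WithLp.toLp 2 fun i => F i t : EuclideanSpace ℂ (Fin n))) 2
      (haarAddCircle : Measure UnitAddCircle) := memLp_piLp_iff.mpr fun i => (hF i).memLp
  have hae : ∀ᵐ t ∂haarAddCircle, ∀ i, hmem.toLp _ t i = F i t :=
    hmem.coeFn_toLp.mono fun t ht i => by rw [ht]
  refine ⟨hmem.toLp _, hae, fun i k => ?_⟩
  rw [vecCoeff, fourierCoeff_congr_ae (hae.mono fun t ht => ht i), (hF i).coeff, coeff_split,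
    mul_neg, neg_add']

theorem exists_mem_HPlus [NeZero n] {x : LaurentSeries ℂ} {p : Fin n → ℂ[X]}
    (hp : ∀ i, ofPoly (p i) = split n x i) :
    ∃ f ∈ HPlus n, (∀ᵐ t ∂haarAddCircle, ∀ i, f t i = (p i).eval (fourier 1 t)) ∧
      ∀ (i : Fin n) (k : ℤ), vecCoeff f i k = x.coeff (-(n * k + (i : ℕ))) := by
  obtain ⟨f, hf, hfx⟩ := exists_Hn_of_hasFourierSeries (x := x)
    (F := fun i t => (p i).eval (fourier 1 t)) fun i => by
      simpa only [mul_one, hp] using HasFourierSeries.one.polynomial_eval_mul (p i)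
  refine ⟨f, fun i k hk => ?_, hf, hfx⟩
  rw [hfx, neg_add', ← mul_neg, ← coeff_split, ← hp, coeff_ofPoly_of_pos _ (by omega)]

theorem isFourierOfMem_of_mem_polySpace [NeZero n] (hnorm : IsNormalized γ)
    (hγ : ∀ i j, MemLp (fun t => γ t i j) 2 haarAddCircle) {y : LaurentSeries ℂ}
    (hy : y ∈ polySpace (loopSeries γ)) :
    IsFourierOfMem (loopSpace γ) fun l => y.coeff (-l) := by
  obtain ⟨x, hx, rfl⟩ := hy
  obtain ⟨p, hp⟩ := exists_ofPoly_eq_split (n := n) hx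
  obtain ⟨h, hh, hht, -⟩ := exists_mem_HPlus hp
  obtain ⟨f, hf, hfy⟩ := exists_Hn_of_hasFourierSeries (x := act (loopSeries γ) x)
    (F := fun i t => ∑ j, γ t i j * (p j).eval (fourier 1 t)) fun i => by
      simp only [split_act, Matrix.mulVec, dotProduct, ← hp, mul_comm (γ _ i _),
        mul_comm (loopSeries γ i _)]
      exact .sum fun j => (hnorm.hasFourierSeries hγ i j).polynomial_eval_mul (p j)
  refine ⟨f, ⟨h, hh, ?_⟩, hfy⟩
  filter_upwards [hf, hht] with t ht ht'
  ext1 i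
  simp only [ht, ht', Matrix.mulVec, dotProduct]

theorem mem_polySpace_of_isFourierOfMem [NeZero n] (hnorm : IsNormalized γ)
    (hγ : ∀ i j, MemLp (fun t => γ t i j) 2 haarAddCircle) (hcell : InBigCell (loopSpace γ))
    {x : LaurentSeries ℂ} (hx : IsFourierOfMem (loopSpace γ) fun l => x.coeff (-l)) :
    x ∈ polySpace (loopSeries γ) := by
  obtain ⟨y, hy, hxy⟩ := hnorm.isUnipotentAtInfty.exists_mem_polySpace_sub x
  obtain ⟨f, hf, hfx⟩ := hx
  obtain ⟨f', hf', hfy⟩ := isFourierOfMem_of_mem_polySpace hnorm hγ hy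
  have htrunc : HahnSeries.truncLT 1 x ∈ polys := fun l hl =>
    HahnSeries.coeff_truncLT_of_le (by omega) x
  obtain ⟨p, hp⟩ := exists_ofPoly_eq_split (n := n) htrunc
  obtain ⟨g, hg, -, hgx⟩ := exists_mem_HPlus hp
  have hff' : f = f' := by
    have hle (i : Fin n) {k : ℤ} (hk : 0 ≤ k) : -(n * k + (i : ℕ)) ≤ 0 := by
      rw [neg_nonpos]
      positivity
    refine (hcell g hg).unique ⟨hf, fun i k hk => ?_⟩ ⟨hf', fun i k hk => ?_⟩
    · rw [hfx, hgx, HahnSeries.coeff_truncLT_of_lt (by linarith [hle i hk])]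
    · rw [hfy, hgx, HahnSeries.coeff_truncLT_of_lt (by linarith [hle i hk]), eq_comm,
        ← sub_eq_zero, ← HahnSeries.coeff_sub]
      exact hxy _ (hle i hk)
  convert hy
  ext l
  obtain ⟨q, i, rfl⟩ := exists_eq_mul_sub n l
  have h := (hfx i (-q)).symm.trans (hff' ▸ hfy i (-q))
  simpa only [mul_neg, neg_add, neg_neg, ← sub_eq_add_neg] using h

end LoopSpace

/-! ## Multipliers of `Ξ(Γ ℂ[z]ⁿ)` -/

theorem coeff_eq_zero_of_dt_eq_zero {f : TimeRing} (hf : dt f = 0) {β : ℕ+ →₀ ℕ} (hβ : β 1 ≠ 0) :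
    MvPowerSeries.coeff β f = 0 := by
  have h := congrArg (MvPowerSeries.coeff (β - Finsupp.single 1 1)) hf
  rw [dt, MvPowerSeries.coeff_pderiv, map_zero, tsub_add_cancel_of_le
    (Finsupp.single_le_iff.mpr (Nat.one_le_iff_ne_zero.mpr hβ))] at h
  exact (mul_eq_zero.mp h).resolve_right (Nat.cast_add_one_ne_zero _)

theorem le_of_add_eq_add_single {ι : Type*} {α β γ : ι →₀ ℕ} {i : ι} {k : ℕ}
    (h : α + β = γ + Finsupp.single i k) (hα : α i = 0) : α ≤ γ := fun j => by
  have hj := DFunLike.congr_fun h j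
  by_cases hij : j = i
  · rw [hij, hα]
    exact Nat.zero_le _
  · rw [Finsupp.add_apply, Finsupp.add_apply, Finsupp.single_eq_of_ne hij] at hj
    omega

theorem hasDeg_coeff_wave {S : PsiDO} (hS : S.IsMonicOfOrderZero) (k : ℕ) :
    HasDeg (MvPowerSeries.coeff (Finsupp.single 1 k) S.wave) k := by
  refine ⟨?_, fun l hl => ?_⟩
  · rw [PsiDO.coeff_wave, waveCoeff_single_self hS]
    exact inv_ne_zero (Nat.cast_ne_zero.mpr k.factorial_ne_zero)
  · rw [← neg_neg l, PsiDO.coeff_wave, waveCoeff_single_of_lt hS.hasOrderLE k (by omega)]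

section Multipliers

variable {n : ℕ} [NeZero n] {Γ : Matrix (Fin n) (Fin n) (LaurentSeries ℂ)} {S : PsiDO}
  {b : LaurentSeries ℂ}

theorem IsUnipotentAtInfty.polySpace_le (hΓ : IsUnipotentAtInfty Γ) {e : ℕ → LaurentSeries ℂ}
    (he : ∀ k, HasDeg (e k) k) (hmem : ∀ k, e k ∈ polySpace Γ)
    {U : Submodule ℂ (LaurentSeries ℂ)} (hU : ∀ k, e k ∈ U) : polySpace Γ ≤ U := by
  suffices h : ∀ N : ℕ, ∀ x ∈ polySpace Γ, (∀ l ≤ -(N : ℤ), x.coeff l = 0) → x ∈ U from fun x hx =>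
    h (1 - x.order).toNat x hx fun l hl => HahnSeries.coeff_eq_zero_of_lt_order (by omega)
  intro N
  induction N with
  | zero =>
    intro x hx h
    rw [hΓ.eq_zero_of_mem_polySpace hx (by simpa using h)]
    exact U.zero_mem
  | succ N ih =>
    intro x hx h
    set c := x.coeff (-N) / (e N).coeff (-N)
    have hsub : x - c • e N ∈ U := by
      refine ih _ (sub_mem hx (Submodule.smul_mem _ c (hmem N))) fun l hl => ?_
      rw [HahnSeries.coeff_sub, HahnSeries.coeff_smul, smul_eq_mul]
      rcases hl.eq_or_lt with rfl | hlt
      · rw [div_mul_cancel₀ _ (he N).1, sub_self]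
      · rw [h l (by push_cast; omega), (he N).2 l hlt, mul_zero, sub_zero]
    simpa only [sub_add_cancel] using add_mem hsub (U.smul_mem c (hU N))

theorem mem_multipliers_of_forall_mul_coeff_wave_mem (hΓ : IsUnipotentAtInfty Γ)
    (hS : S.IsMonicOfOrderZero) (hV : S.wave ∈ valuesIn (polySpace Γ))
    (hb : ∀ k, b * MvPowerSeries.coeff (Finsupp.single 1 k) S.wave ∈ polySpace Γ) :
    b ∈ multipliers (polySpace Γ) := by
  have h : polySpace Γ ≤ (polySpace Γ).comap (act (n := n) (evalLam b)) := by
    refine hΓ.polySpace_le (hasDeg_coeff_wave hS) (fun _ => hV _) fun k => ?_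
    rw [Submodule.mem_comap, act_evalLam]
    exact hb k
  intro x hx
  simpa only [Submodule.mem_comap, act_evalLam] using h hx

theorem eq_zero_of_wave_mem_valuesIn (hΓ : IsUnipotentAtInfty Γ) {T : PsiDO}
    (hT : T.HasOrderLE (-1)) (hV : T.wave ∈ valuesIn (polySpace Γ)) : T = 0 := by
  refine PsiDO.symbol_injective (MvPowerSeries.ext fun α => ?_)
  rw [map_zero, map_zero]
  induction α using WellFoundedLT.induction with
  | ind α ih =>
    have hα := hV α
    rw [PsiDO.wave_apply, MvPowerSeries.coeff_mul, Finset.sum_eq_single (0, α)] at hα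
    · rw [coeff_expXi] at hα
      refine hΓ.eq_zero_of_mem_polySpace (by simpa [expCoeff] using hα) fun l hl => ?_
      rw [PsiDO.coeff_symbol, hT _ (by omega), map_zero]
    · rintro ⟨γ, β⟩ hγβ hne
      rw [Finset.HasAntidiagonal.mem_antidiagonal] at hγβ
      have hβ : β ≠ α := by
        rintro rfl
        exact hne (Prod.ext (add_eq_right.mp hγβ) rfl)
      rw [ih β ((le_of_le_of_eq le_add_self hγβ).lt_of_ne hβ), mul_zero]
    · exact fun h => absurd (Finset.HasAntidiagonal.mem_antidiagonal.mpr (zero_add α)) h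

theorem coeff_symbol_mem_multipliers (hΓ : IsUnipotentAtInfty Γ) (hS : S.IsMonicOfOrderZero)
    (hV : S.wave ∈ valuesIn (polySpace Γ)) {P : PsiDO} (hP : ∀ k, dt (P.coeff k) = 0)
    (hSP : (S * P).wave ∈ valuesIn (polySpace Γ)) (β : ℕ+ →₀ ℕ) :
    MvPowerSeries.coeff β P.symbol ∈ multipliers (polySpace Γ) := by
  have hzero {β : ℕ+ →₀ ℕ} (hβ : β 1 ≠ 0) : MvPowerSeries.coeff β P.symbol = 0 := by
    ext l
    rw [PsiDO.coeff_symbol, coeff_eq_zero_of_dt_eq_zero (hP _) hβ, HahnSeries.coeff_zero]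
  rw [PsiDO.wave_mul_of_dt_eq_zero S hP] at hSP
  induction β using WellFoundedLT.induction with
  | ind β ih =>
    by_cases hβ : β 1 = 0
    swap
    · rw [hzero hβ]
      exact zero_mem _
    refine mem_multipliers_of_forall_mul_coeff_wave_mem hΓ hS hV fun k => ?_
    have hsum := hSP (β + Finsupp.single 1 k)
    rw [MvPowerSeries.coeff_mul, ← Finset.add_sum_erase (a := (β, Finsupp.single 1 k)) _ _
      (Finset.HasAntidiagonal.mem_antidiagonal.mpr rfl)] at hsum
    refine ((polySpace Γ).add_mem_iff_left (Submodule.sum_mem _ ?_)).mp hsum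
    rintro ⟨γ, δ⟩ hγδ
    rw [Finset.mem_erase, Finset.HasAntidiagonal.mem_antidiagonal] at hγδ
    by_cases hγ : γ 1 = 0
    swap
    · rw [hzero hγ, zero_mul]
      exact zero_mem _
    have hne : γ ≠ β := by
      rintro rfl
      exact hγδ.1 (Prod.ext rfl (add_left_cancel hγδ.2))
    exact ih γ ((le_of_add_eq_add_single hγδ.2 hγ).lt_of_ne hne) _ (hV δ)

theorem mem_multipliers_of_conj (hΓ : IsUnipotentAtInfty Γ) (hS : S.IsMonicOfOrderZero)
    (hV : S.wave ∈ valuesIn (polySpace Γ)) {M : PsiDO} (hM : ∀ k < 0, M.coeff k = 0)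
    (hMS : M * S = S * PsiDO.ofLaurent b) : b ∈ multipliers (polySpace Γ) := by
  simpa [PsiDO.symbol_ofLaurent] using coeff_symbol_mem_multipliers hΓ hS hV
    (PsiDO.dt_coeff_ofLaurent b) (hMS ▸ wave_mul_mem_valuesIn hM hV) 0

theorem exists_conj_of_mem_multipliers (hΓ : IsUnipotentAtInfty Γ) (hS : S.IsMonicOfOrderZero)
    (hV : S.wave ∈ valuesIn (polySpace Γ)) (hb : b ∈ multipliers (polySpace Γ)) :
    ∃ M : PsiDO, (∀ k < 0, M.coeff k = 0) ∧ M * S = S * PsiDO.ofLaurent b := by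
  obtain ⟨u, rfl⟩ := hS.isUnit
  set X : PsiDO := u * PsiDO.ofLaurent b * (u⁻¹ : PsiDOˣ)
  have hXu : X * u = u * PsiDO.ofLaurent b := Units.inv_mul_cancel_right _ u
  refine ⟨X.diffPart, fun k => X.coeff_diffPart_of_neg, ?_⟩
  have hneg : (X - X.diffPart) * u = 0 := by
    refine eq_zero_of_wave_mem_valuesIn hΓ
      ((hS.hasOrderLE_mul_right_iff).mpr X.hasOrderLE_sub_diffPart) ?_
    rw [sub_mul, hXu, map_sub, PsiDO.wave_mul_ofLaurent]
    exact sub_mem (C_mul_mem_valuesIn hb hV)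
      (wave_mul_mem_valuesIn (fun k => X.coeff_diffPart_of_neg) hV)
  rw [← hXu, ← sub_eq_zero.mp ((sub_mul _ _ _).symm.trans hneg)]

theorem act_conj_mem_polys (hΓ : IsUnipotentAtInfty Γ) (hb : b ∈ multipliers (polySpace Γ))
    {x : LaurentSeries ℂ} (hx : x ∈ polys) : act (Γ⁻¹ * evalLam b * Γ) x ∈ polys := by
  obtain ⟨y, hy, hyx⟩ := hb _ (Submodule.mem_map_of_mem hx)
  rw [Matrix.mul_assoc, act_mul, act_mul, act_evalLam, ← hyx, ← act_mul,
    Matrix.nonsing_inv_mul _ hΓ.isUnit_det, act_one]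
  exact hy

theorem exists_polySeries_eq_conj (hΓ : IsUnipotentAtInfty Γ) (hb : b ∈ multipliers (polySpace Γ)) :
    ∃ C : Matrix (Fin n) (Fin n) ℂ[X], polySeries C = Γ⁻¹ * evalLam b * Γ := by
  have h (i j : Fin n) : ∃ p, ofPoly p = (Γ⁻¹ * evalLam b * Γ : Matrix _ _ _) i j := by
    refine exists_ofPoly_eq fun q hq => ?_
    rw [← coeff_act_single]
    refine act_conj_mem_polys hΓ hb (fun l hl => HahnSeries.coeff_single_of_ne (by omega)) _ ?_
    have := i.isLt
    nlinarith
  choose C hC using h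
  exact ⟨Matrix.of C, Matrix.ext hC⟩

theorem trace_evalLam (b : LaurentSeries ℂ) :
    (evalLam b : Matrix (Fin n) (Fin n) (LaurentSeries ℂ)).trace = n • split n b 0 := by
  have h (i : Fin n) : evalLam b i i = split n b 0 := by
    ext q
    rw [evalLam_coeff, coeff_split, sub_add_cancel, Fin.val_zero, Nat.cast_zero, sub_zero]
  simp [Matrix.trace, h]

theorem ofPoly_trace (hΓ : IsUnipotentAtInfty Γ) {C : Matrix (Fin n) (Fin n) ℂ[X]}
    (hC : polySeries C = Γ⁻¹ * evalLam b * Γ) : ofPoly C.trace = n • split n b 0 := by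
  have h : ofPoly C.trace = (polySeries C).trace := by
    simp only [Matrix.trace, map_sum]
    rfl
  rw [h, hC, Matrix.trace_mul_comm, Matrix.mul_nonsing_inv_cancel_left _ _ hΓ.isUnit_det,
    trace_evalLam]

theorem substPow_ofPoly (p : ℂ[X]) : substPow n (ofPoly p) = ofPoly (expand ℂ n p) := by
  induction p using Polynomial.induction_on' with
  | add p q hp hq => rw [map_add, map_add, hp, hq, map_add, map_add]
  | monomial k c =>
    rw [ofPoly_monomial, substPow_single, expand_monomial, ofPoly_monomial]
    push_cast
    ring_nf

theorem substPow_ofPoly_mem_multipliers (Γ : Matrix (Fin n) (Fin n) (LaurentSeries ℂ)) (p : ℂ[X]) :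
    substPow n (ofPoly p) ∈ multipliers (polySpace Γ) := by
  rintro _ ⟨x, hx, rfl⟩
  obtain ⟨q, rfl⟩ := exists_ofPoly_eq hx
  rw [← act_substPow_mul, substPow_ofPoly, ← map_mul]
  exact Submodule.mem_map_of_mem fun l hl => coeff_ofPoly_of_pos _ hl

variable (n) in
/-- The series `b` with all powers of `zⁿ` removed, so that `tracelessPart n b` evaluated at `Λ` has
trace `0`. -/
def tracelessPart (b : LaurentSeries ℂ) : LaurentSeries ℂ :=
  b - substPow n (split n b 0)

theorem coeff_tracelessPart_mul (b : LaurentSeries ℂ) (s : ℤ) :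
    (tracelessPart n b).coeff (n * s) = 0 := by
  rw [tracelessPart, HahnSeries.coeff_sub, coeff_substPow, coeff_split]
  simp

theorem coeff_tracelessPart_of_not_dvd (b : LaurentSeries ℂ) {l : ℤ} (hl : ¬ (n : ℤ) ∣ l) :
    (tracelessPart n b).coeff l = b.coeff l := by
  rw [tracelessPart, HahnSeries.coeff_sub, coeff_substPow_of_not_dvd _ hl, sub_zero]

theorem tracelessPart_mem_multipliers (hΓ : IsUnipotentAtInfty Γ)
    (hb : b ∈ multipliers (polySpace Γ)) : tracelessPart n b ∈ multipliers (polySpace Γ) := by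
  obtain ⟨C, hC⟩ := exists_polySeries_eq_conj hΓ hb
  obtain ⟨p, hp⟩ := exists_ofPoly_eq (x := split n b 0) fun l hl => by
    have h := coeff_ofPoly_of_pos C.trace hl
    rw [ofPoly_trace hΓ hC, HahnSeries.coeff_smul] at h
    exact (smul_eq_zero.mp h).resolve_left (NeZero.ne n)
  rw [tracelessPart, ← hp]
  exact sub_mem hb (substPow_ofPoly_mem_multipliers Γ p)

end Multipliers

/-! ## Burchnall-Chaundy data -/

theorem commute_ofLaurent (b c : LaurentSeries ℂ) :
    Commute (PsiDO.ofLaurent b) (PsiDO.ofLaurent c) :=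
  (Commute.all b c).map PsiDO.ofLaurentHom

theorem commute_iff_of_semiconjBy {R : Type*} [Monoid R] {S P Q L M : R} (hS : IsUnit S)
    (hL : SemiconjBy S P L) (hM : SemiconjBy S Q M) : Commute L M ↔ Commute P Q := by
  rw [Commute, SemiconjBy, ← hS.mul_left_inj, ← (hL.mul_right hM).eq, ← (hM.mul_right hL).eq,
    hS.mul_right_inj]
  rfl

section BCData

variable {n m : ℕ} [NeZero n] {Γ : Matrix (Fin n) (Fin n) (LaurentSeries ℂ)} {S L M : PsiDO}

theorem IsDressing.wave_mem_valuesIn {γ : MatLoop n} {S : PsiDO} (hnorm : IsNormalized γ)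
    (hγ : ∀ i j, MemLp (fun t => γ t i j) 2 haarAddCircle) (hcell : InBigCell (loopSpace γ))
    (hS : IsDressing (loopSpace γ) S) : S.wave ∈ valuesIn (polySpace (loopSeries γ)) := fun α => by
  refine mem_polySpace_of_isFourierOfMem hnorm hγ hcell ?_
  simp only [PsiDO.coeff_wave]
  exact hS.2 α

theorem exists_mem_multipliers_of_commute (hΓ : IsUnipotentAtInfty Γ) (hS : S.IsMonicOfOrderZero)
    (hV : S.wave ∈ valuesIn (polySpace Γ)) (hL : L * S = S * PsiDO.Dpow n)
    (hM : M.IsDiffOfOrder m) (hLM : Commute L M) :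
    ∃ c ∈ multipliers (polySpace Γ), HasDeg c m := by
  obtain ⟨u, rfl⟩ := hS.isUnit
  set P : PsiDO := (u⁻¹ : PsiDOˣ) * (M * u)
  have hP : M * u = u * P := (Units.mul_inv_cancel_left u _).symm
  have hdt := PsiDO.dt_coeff_eq_zero_of_commute (NeZero.ne n)
    ((commute_iff_of_semiconjBy u.isUnit hL.symm hP.symm).mp hLM)
  have hMm : M.HasOrderLE m := fun k hk => hM.2 k (.inr hk)
  have hPm : P.HasOrderLE m := (hS.hasOrderLE_iff_of_conj hP).mp hMm
  have hlead : P.coeff m ≠ 0 := hS.coeff_eq_of_conj hP hPm ▸ hM.1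
  obtain ⟨β, hβ⟩ := (MvPowerSeries.ne_zero_iff_exists_coeff_ne_zero _).mp hlead
  refine ⟨_, coeff_symbol_mem_multipliers hΓ hS hV hdt
    (hP ▸ wave_mul_mem_valuesIn (fun k hk => hM.2 k (.inl hk)) hV) β, ?_, fun l hl => ?_⟩
  · rwa [PsiDO.coeff_symbol, neg_neg]
  · rw [PsiDO.coeff_symbol, hPm _ (by omega), map_zero]

theorem exists_normalized_mem_multipliers (hΓ : IsUnipotentAtInfty Γ) (hmn : ¬ n ∣ m)
    {c : LaurentSeries ℂ} (hc : c ∈ multipliers (polySpace Γ)) (hcm : HasDeg c m) :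
    ∃ b ∈ multipliers (polySpace Γ), b.coeff (-m) = 1 ∧ (∀ l < -(m : ℤ), b.coeff l = 0) ∧
      ∀ s : ℤ, b.coeff (n * s) = 0 := by
  refine ⟨tracelessPart n ((c.coeff (-m))⁻¹ • c), tracelessPart_mem_multipliers hΓ fun x hx => ?_,
    ?_, fun l hl => ?_, coeff_tracelessPart_mul _⟩
  · rw [← HahnSeries.C_mul_eq_smul, mul_assoc, HahnSeries.C_mul_eq_smul]
    exact Submodule.smul_mem _ _ (hc x hx)
  · rw [coeff_tracelessPart_of_not_dvd _ (by rwa [dvd_neg, Int.natCast_dvd_natCast]),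
      HahnSeries.coeff_smul, smul_eq_mul, inv_mul_cancel₀ hcm.1]
  · by_cases hdvd : (n : ℤ) ∣ l
    · obtain ⟨s, rfl⟩ := hdvd
      exact coeff_tracelessPart_mul _ s
    · rw [coeff_tracelessPart_of_not_dvd _ hdvd, HahnSeries.coeff_smul, hcm.2 l hl, smul_zero]

theorem exists_isBCData {γ : MatLoop n} (hn : n ≠ 1) (hnorm : IsNormalized γ)
    (hγ : ∀ i j, MemLp (fun t => γ t i j) 2 haarAddCircle) (hcell : InBigCell (loopSpace γ))
    (hBC : InBCLocus (loopSpace γ) m) :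
    ∃ (S L M : PsiDO) (b : LaurentSeries ℂ), IsBCData (loopSpace γ) m S L M b := by
  obtain ⟨hmn, S, L, M₀, hlax, hM₀, hLM₀⟩ := hBC
  have hΓ := hnorm.isUnipotentAtInfty
  have hS : S.IsMonicOfOrderZero := hlax.1.1
  have hV := hlax.1.wave_mem_valuesIn hnorm hγ hcell
  obtain ⟨c, hc, hcm⟩ := exists_mem_multipliers_of_commute hΓ hS hV
    (hlax.2.trans (by rw [PsiDO.ofLaurent_single])) hM₀ hLM₀
  obtain ⟨b, hb, hlead, horder, htraceless⟩ := exists_normalized_mem_multipliers hΓ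
    (fun h => hn (Nat.Coprime.eq_one_of_dvd hmn.symm h)) hc hcm
  obtain ⟨M, hM, hMS⟩ := exists_conj_of_mem_multipliers hΓ hS hV hb
  have hbm : (PsiDO.ofLaurent b).HasOrderLE m := fun k hk => by
    rw [PsiDO.coeff_ofLaurent, horder _ (by omega), map_zero]
  have hMm : M.HasOrderLE m := (hS.hasOrderLE_iff_of_conj hMS).mpr hbm
  have hMlead : M.coeff m ≠ 0 := by
    rw [hS.coeff_eq_of_conj hMS hbm, PsiDO.coeff_ofLaurent, hlead, map_one]
    exact one_ne_zero
  exact ⟨S, L, M, b, {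
    lax := hlax
    diff := ⟨hMlead, fun k hk => hk.elim (hM k) (hMm k)⟩
    comm := (commute_iff_of_semiconjBy hS.isUnit hlax.2.symm hMS.symm).mpr (commute_ofLaurent _ _)
    conj := hMS
    lead := hlead
    order := fun k hk => horder _ (by omega)
    traceless := fun s => by rw [← mul_neg, htraceless] }⟩

end BCData

/-! ## Degrees of the entries -/

section Degrees

variable {n m : ℕ} [NeZero n]

theorem IsUnipotentAtInfty.hasDeg_act_conj {Γ : Matrix (Fin n) (Fin n) (LaurentSeries ℂ)}
    (hΓ : IsUnipotentAtInfty Γ) {b x : LaurentSeries ℂ} {d N : ℤ} (hb : HasDeg b d)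
    (hx : HasDeg x N) : HasDeg (act (Γ⁻¹ * evalLam b * Γ) x) (d + N) := by
  set y := act (Γ⁻¹ * evalLam b * Γ) x
  have hy : act Γ y = b * act Γ x := by
    rw [← act_mul, Matrix.mul_assoc, Matrix.mul_nonsing_inv_cancel_left _ _ hΓ.isUnit_det,
      act_mul, act_evalLam]
  have hdeg : HasDeg (act Γ y) (d + N) := hy ▸ hb.mul (hΓ.hasDeg_act hx)
  obtain ⟨N', hN'⟩ := exists_hasDeg (x := y) fun h => hdeg.ne_zero (by rw [h, map_zero])
  rwa [hdeg.unique (hΓ.hasDeg_act hN')]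

variable {C : Matrix (Fin n) (Fin n) ℂ[X]}

theorem coeff_act_polySeries_single (i j : Fin n) (k : ℕ) :
    (act (polySeries C) (HahnSeries.single (-((j : ℕ) : ℤ)) 1)).coeff (-(n * k + (i : ℕ))) =
      (C i j).coeff k := by
  rw [neg_add', ← mul_neg, coeff_act_single]
  exact coeff_ofPoly _ k

theorem entry_degree_le
    (hC : ∀ j : Fin n,
      HasDeg (act (polySeries C) (HahnSeries.single (-((j : ℕ) : ℤ)) 1)) (m + (j : ℕ)))
    {i j : Fin n} (hij : C i j ≠ 0) :
    ((i : ℕ) : ℤ) - ((j : ℕ) : ℤ) + n * (C i j).natDegree ≤ m := by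
  by_contra h
  refine leadingCoeff_ne_zero.mpr hij ?_
  rw [leadingCoeff, ← coeff_act_polySeries_single]
  exact (hC j).2 _ (by omega)

theorem entry_degree_eq
    (hC : ∀ j : Fin n,
      HasDeg (act (polySeries C) (HahnSeries.single (-((j : ℕ) : ℤ)) 1)) (m + (j : ℕ)))
    {i j : Fin n} (h : (m + j : ℕ) % n = i) :
    C i j ≠ 0 ∧ (m : ℤ) = ((i : ℕ) : ℤ) - ((j : ℕ) : ℤ) + n * (C i j).natDegree := by
  have hdiv : (n : ℤ) * ((m + j : ℕ) / n : ℕ) + (i : ℕ) = m + (j : ℕ) := by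
    exact_mod_cast h ▸ Nat.div_add_mod (m + j : ℕ) n
  have hcoeff : (C i j).coeff ((m + j : ℕ) / n) ≠ 0 := by
    rw [← coeff_act_polySeries_single, hdiv]
    exact (hC j).1
  have hij : C i j ≠ 0 := fun h0 => hcoeff (by rw [h0, coeff_zero])
  have hdeg := Nat.mul_le_mul_left n (le_natDegree_of_ne_zero hcoeff)
  have hle := entry_degree_le hC hij
  zify at hdeg hdiv
  exact ⟨hij, by linarith⟩

theorem isGreatest_col
    (hC : ∀ j : Fin n,
      HasDeg (act (polySeries C) (HahnSeries.single (-((j : ℕ) : ℤ)) 1)) (m + (j : ℕ)))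
    (j : Fin n) :
    IsGreatest {d : ℤ | ∃ i, C i j ≠ 0 ∧
      d = ((i : ℕ) : ℤ) - ((j : ℕ) : ℤ) + n * (C i j).natDegree} m := by
  refine ⟨⟨⟨(m + j : ℕ) % n, Nat.mod_lt _ (NeZero.pos n)⟩, entry_degree_eq hC rfl⟩, ?_⟩
  rintro d ⟨i, hi, rfl⟩
  exact entry_degree_le hC hi

theorem isGreatest_row
    (hC : ∀ j : Fin n,
      HasDeg (act (polySeries C) (HahnSeries.single (-((j : ℕ) : ℤ)) 1)) (m + (j : ℕ)))
    (i : Fin n) :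
    IsGreatest {d : ℤ | ∃ j, C i j ≠ 0 ∧
      d = ((i : ℕ) : ℤ) - ((j : ℕ) : ℤ) + n * (C i j).natDegree} m := by
  refine ⟨⟨⟨(i + (n - 1) * m) % n, Nat.mod_lt _ (NeZero.pos n)⟩, entry_degree_eq hC ?_⟩, ?_⟩
  · have hsum : m + (i + (n - 1) * m) = i + n * m := by
      obtain ⟨k, rfl⟩ := Nat.exists_eq_add_one.mpr (NeZero.pos n)
      rw [Nat.add_sub_cancel]
      ring
    rw [Nat.add_mod_mod, hsum, Nat.add_mul_mod_self_left, Nat.mod_eq_of_lt i.isLt]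
  · rintro d ⟨j, hj, rfl⟩
    exact entry_degree_le hC hj

end Degrees

/-! ## The spectral curve -/

section Curve

variable {n m : ℕ} {Γ : Matrix (Fin n) (Fin n) (LaurentSeries ℂ)} {b : LaurentSeries ℂ}
  {C : Matrix (Fin n) (Fin n) ℂ[X]}

theorem map_charpoly_of_conj (hΓ : IsUnit Γ.det) (hC : polySeries C = Γ⁻¹ * evalLam b * Γ) :
    C.charpoly.map ofPoly.toRingHom =
      (evalLam b : Matrix (Fin n) (Fin n) (LaurentSeries ℂ)).charpoly := by
  rw [← Matrix.charpoly_map]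
  change (polySeries C).charpoly = _
  rw [hC, Matrix.charpoly_mul_comm, Matrix.mul_nonsing_inv_cancel_left _ _ hΓ]

variable [NeZero n]

/-- The evaluation `F(z, λ) ↦ F(zⁿ, b(z))`, whose kernel is the ideal of the spectral curve. -/
def curveHom (n : ℕ) [NeZero n] (b : LaurentSeries ℂ) : ℂ[X][X] →+* LaurentSeries ℂ :=
  eval₂RingHom ((substPow n).comp ofPoly.toRingHom) b

theorem curveHom_apply (b : LaurentSeries ℂ) (F : ℂ[X][X]) :
    curveHom n b F = eval₂ ((substPow n).comp ofPoly.toRingHom) b F := rfl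

theorem evalLam_curveHom (b : LaurentSeries ℂ) (F : ℂ[X][X]) :
    (evalLam (curveHom n b F) : Matrix (Fin n) (Fin n) (LaurentSeries ℂ)) =
      aeval (evalLam b) (F.map ofPoly.toRingHom) := by
  rw [← evalLamHom_apply, curveHom_apply, hom_eval₂, aeval_def, eval₂_map]
  congr 1
  exact RingHom.ext fun p => evalLam_substPow (ofPoly p)

theorem curveHom_charpoly (hΓ : IsUnit Γ.det) (hC : polySeries C = Γ⁻¹ * evalLam b * Γ) :
    curveHom n b C.charpoly = 0 := by
  refine (evalLamHom n).injective ?_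
  rw [evalLamHom_apply, evalLam_curveHom, map_charpoly_of_conj hΓ hC,
    Matrix.aeval_self_charpoly, map_zero]

theorem eq_zero_of_curveHom_eq_zero (hmn : Nat.Coprime m n) (hb : HasDeg b m) {R : ℂ[X][X]}
    (hR : R.natDegree < n) (h : curveHom n b R = 0) : R = 0 := by
  rw [curveHom_apply, eval₂_eq_sum_range' _ hR] at h
  have hdeg {j : ℕ} (hj : R.coeff j ≠ 0) :
      HasDeg (substPow n (ofPoly (R.coeff j)) * b ^ j) (n * (R.coeff j).natDegree + j * m) :=
    ((hasDeg_ofPoly hj).substPow n).mul (hb.pow j)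
  -- `n a + j m` determines `j` modulo `n`, so the terms have pairwise distinct degrees.
  have hinj : Set.InjOn (fun j : ℕ => (n * (R.coeff j).natDegree + j * m : ℤ))
      (Finset.range n) := fun i hi j hj hij => by
    have hdvd : (n : ℤ) ∣ i - j :=
      IsCoprime.dvd_of_dvd_mul_right (Nat.isCoprime_iff_coprime.mpr hmn.symm)
        ⟨(R.coeff j).natDegree - (R.coeff i).natDegree, by linear_combination hij⟩
    rw [Finset.coe_range, Set.mem_Iio] at hi hj
    have := Int.eq_zero_of_abs_lt_dvd hdvd (by rw [abs_lt]; omega)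
    omega
  have hzero := eq_zero_of_sum_eq_zero hinj (fun j _ hj => hdeg fun h0 => hj (by simp [h0])) h
  ext1 j
  by_contra hj
  have hjn : j < n := (le_natDegree_of_ne_zero hj).trans_lt hR
  exact (hdeg hj).ne_zero (hzero j (Finset.mem_range.mpr hjn))

theorem curveHom_eq_zero_iff (hΓ : IsUnit Γ.det) (hC : polySeries C = Γ⁻¹ * evalLam b * Γ)
    (hmn : Nat.Coprime m n) (hb : HasDeg b m) (F : ℂ[X][X]) :
    curveHom n b F = 0 ↔ C.charpoly ∣ F := by
  have hχ := curveHom_charpoly hΓ hC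
  have hmonic := C.charpoly_monic
  have hdeg : C.charpoly.natDegree = n := by
    rw [Matrix.charpoly_natDegree_eq_dim, Fintype.card_fin]
  refine ⟨fun h => ?_, ?_⟩
  · rw [← modByMonic_eq_zero_iff_dvd hmonic]
    refine eq_zero_of_curveHom_eq_zero hmn hb ?_ ?_
    · refine (natDegree_modByMonic_lt F hmonic fun h1 => NeZero.ne n ?_).trans_eq hdeg
      rw [← hdeg, h1, natDegree_one]
    · rw [modByMonic_eq_sub_mul_div, map_sub, map_mul, hχ, h, zero_mul, sub_zero]
  · rintro ⟨G, rfl⟩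
    rw [map_mul, hχ, zero_mul]

theorem irreducible_charpoly (hΓ : IsUnit Γ.det) (hC : polySeries C = Γ⁻¹ * evalLam b * Γ)
    (hmn : Nat.Coprime m n) (hb : HasDeg b m) : Irreducible C.charpoly := by
  have hiff := curveHom_eq_zero_iff hΓ hC hmn hb
  refine Prime.irreducible ⟨C.charpoly_monic.ne_zero, fun h => ?_, fun F G h => ?_⟩
  · exact (h.map (curveHom n b)).ne_zero (curveHom_charpoly hΓ hC)
  · rw [← hiff, map_mul] at h
    exact (mul_eq_zero.mp h).imp (hiff F).mp (hiff G).mp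

theorem trace_eq_zero (hΓ : IsUnipotentAtInfty Γ) (hC : polySeries C = Γ⁻¹ * evalLam b * Γ)
    (hb : ∀ s : ℤ, b.coeff (n * s) = 0) : C.trace = 0 := by
  refine ofPoly_injective ?_
  have hsplit : split n b 0 = 0 := by
    ext q
    rw [coeff_split, Fin.val_zero, Nat.cast_zero, sub_zero, hb, HahnSeries.coeff_zero]
  rw [ofPoly_trace hΓ hC, hsplit, smul_zero, map_zero]

end Curve

/-! ## Polynomial relations between `L` and `M` -/

namespace PsiDO

theorem mul_ofLaurent_C (c : ℂ) (P : PsiDO) :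
    P * ofLaurent (HahnSeries.C c) = (MvPowerSeries.C c : TimeRing) • P := by
  have hC : timeToWave (MvPowerSeries.C c) = MvPowerSeries.C (HahnSeries.C c) :=
    MvPowerSeries.map_C _ _
  refine symbol_injective ?_
  rw [symbol_mul_of_dt_eq_zero _ (dt_coeff_ofLaurent _), symbol_ofLaurent, map_smulₛₗ, hC,
    smul_eq_mul, mul_comm]

theorem ofLaurent_C_mul (c : ℂ) (P : PsiDO) :
    ofLaurent (HahnSeries.C c) * P = (MvPowerSeries.C c : TimeRing) • P := by
  rw [← one_mul (ofLaurent _), mul_ofLaurent_C, smul_mul_assoc, one_mul]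

theorem commute_ofLaurent_C (c : ℂ) (P : PsiDO) : Commute P (ofLaurent (HahnSeries.C c)) :=
  (mul_ofLaurent_C c P).trans (ofLaurent_C_mul c P).symm

end PsiDO

/-- The operator `F(L, M)` whose vanishing is `Annihilates F L M`; powers of `L` stand to the
left of those of `M`. -/
def relation (F : ℂ[X][X]) (L M : PsiDO) : PsiDO :=
  ∑ j ∈ F.support, ∑ i ∈ (F.coeff j).support,
    PsiDO.ofLaurent (HahnSeries.C ((F.coeff j).coeff i)) * (L ^ i * M ^ j)

theorem annihilates_iff_relation_eq_zero {F : ℂ[X][X]} {L M : PsiDO} :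
    Annihilates F L M ↔ relation F L M = 0 := by
  rw [PsiDO.ext_iff, funext_iff]
  refine forall_congr' fun k => ?_
  simp only [relation, PsiDO.coeff_sum, PsiDO.ofLaurent_C_mul, PsiDO.coeff_smul,
    MvPowerSeries.smul_eq_C_mul, PsiDO.npow_eq_pow, PsiDO.coeff_zero]

theorem semiconjBy_relation {S P Q L M : PsiDO} (hL : SemiconjBy S P L) (hM : SemiconjBy S Q M)
    (F : ℂ[X][X]) : SemiconjBy S (relation F P Q) (relation F L M) := by
  have hterm (c : ℂ) (i j : ℕ) := (SemiconjBy.mul_right (PsiDO.commute_ofLaurent_C c S)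
    ((hL.pow_right i).mul_right (hM.pow_right j))).eq
  simp only [SemiconjBy, relation, Finset.mul_sum, Finset.sum_mul, hterm]

theorem substPow_ofPoly_eq_sum (n : ℕ) [NeZero n] (p : ℂ[X]) : substPow n (ofPoly p) =
    ∑ i ∈ p.support, HahnSeries.C (p.coeff i) * HahnSeries.single (-(n : ℤ)) 1 ^ i := by
  conv_lhs => rw [p.as_sum_support, map_sum, map_sum]
  refine Finset.sum_congr rfl fun i _ => ?_
  rw [ofPoly_monomial, substPow_single, HahnSeries.single_pow, HahnSeries.C_apply,
    HahnSeries.single_mul_single, zero_add, one_pow, mul_one, nsmul_eq_mul, mul_neg, mul_neg,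
    mul_comm (n : ℤ)]

theorem relation_ofLaurent {n : ℕ} [NeZero n] (b : LaurentSeries ℂ) (F : ℂ[X][X]) :
    relation F (PsiDO.ofLaurent (HahnSeries.single (-(n : ℤ)) 1)) (PsiDO.ofLaurent b) =
      PsiDO.ofLaurent (curveHom n b F) := by
  have hcurve : curveHom n b F = ∑ j ∈ F.support, ∑ i ∈ (F.coeff j).support,
      HahnSeries.C ((F.coeff j).coeff i) * (HahnSeries.single (-(n : ℤ)) 1 ^ i * b ^ j) := by
    simp only [curveHom_apply, eval₂_eq_sum, Polynomial.sum, ← mul_assoc, ← Finset.sum_mul,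
      ← substPow_ofPoly_eq_sum]
    rfl
  change _ = PsiDO.ofLaurentHom _
  simp only [hcurve, map_sum, map_mul, map_pow]
  rfl

theorem annihilates_iff {n : ℕ} [NeZero n] {S L M : PsiDO} {b : LaurentSeries ℂ} (hS : IsUnit S)
    (hL : L * S = S * PsiDO.ofLaurent (HahnSeries.single (-(n : ℤ)) 1))
    (hM : M * S = S * PsiDO.ofLaurent b) (F : ℂ[X][X]) :
    Annihilates F L M ↔ curveHom n b F = 0 := by
  have hrel := semiconjBy_relation hL.symm hM.symm F
  rw [relation_ofLaurent] at hrel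
  rw [annihilates_iff_relation_eq_zero, ← hS.mul_left_eq_zero, ← hrel.eq, hS.mul_right_eq_zero]
  exact map_eq_zero_iff PsiDO.ofLaurentHom PsiDO.ofLaurentHom.injective

theorem IsBCData.hasDeg {n m : ℕ} {W : Set (Hn n)} {S L M : PsiDO} {b : LaurentSeries ℂ}
    (h : IsBCData W m S L M b) : HasDeg b m :=
  ⟨h.lead ▸ one_ne_zero, fun l hl => neg_neg l ▸ h.order (-l) (by omega)⟩

end GelfandDickey

end

theorem mainTheorem11_general (n m : ℕ) (hn : 2 ≤ n)
    (γ : GelfandDickey.MatLoop n)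
    (hγ : ∀ i j, MemLp (fun t => γ t i j) 2 haarAddCircle)
    (hnorm : GelfandDickey.IsNormalized γ)
    (hcell : GelfandDickey.InBigCell (GelfandDickey.loopSpace γ))
    (hBC : GelfandDickey.InBCLocus (GelfandDickey.loopSpace γ) m) :
    (∃ (S L M : GelfandDickey.PsiDO) (b : LaurentSeries ℂ),
      GelfandDickey.IsBCData (GelfandDickey.loopSpace γ) m S L M b) ∧
    ∀ (S L M : GelfandDickey.PsiDO) (b : LaurentSeries ℂ),
      GelfandDickey.IsBCData (GelfandDickey.loopSpace γ) m S L M b →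
      ∃ C : Matrix (Fin n) (Fin n) (Polynomial ℂ),
        GelfandDickey.polySeries C =
          (GelfandDickey.loopSeries γ)⁻¹ * GelfandDickey.evalLam b * GelfandDickey.loopSeries γ ∧
        C.trace = 0 ∧
        (∀ j, IsGreatest {d : ℤ | ∃ i, C i j ≠ 0 ∧
          d = ((i : ℕ) : ℤ) - ((j : ℕ) : ℤ) + n * (C i j).natDegree} m) ∧
        (∀ i, IsGreatest {d : ℤ | ∃ j, C i j ≠ 0 ∧
          d = ((i : ℕ) : ℤ) - ((j : ℕ) : ℤ) + n * (C i j).natDegree} m) ∧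
        Irreducible C.charpoly ∧
        ∀ F : Polynomial (Polynomial ℂ),
          GelfandDickey.Annihilates F L M ↔ C.charpoly ∣ F := by
  have : NeZero n := ⟨by omega⟩
  have hΓ := hnorm.isUnipotentAtInfty
  refine ⟨GelfandDickey.exists_isBCData (by omega) hnorm hγ hcell hBC, fun S L M b h => ?_⟩
  have hS := h.lax.1.1
  have hmult := GelfandDickey.mem_multipliers_of_conj hΓ hS
    (h.lax.1.wave_mem_valuesIn hnorm hγ hcell) (fun k hk => h.diff.2 k (.inl hk)) h.conj
  obtain ⟨C, hC⟩ := GelfandDickey.exists_polySeries_eq_conj hΓ hmult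
  have hcol (j : Fin n) : GelfandDickey.HasDeg (GelfandDickey.act (GelfandDickey.polySeries C)
      (HahnSeries.single (-((j : ℕ) : ℤ)) 1)) (m + (j : ℕ)) :=
    hC ▸ hΓ.hasDeg_act_conj h.hasDeg (GelfandDickey.hasDeg_single one_ne_zero)
  have hcurve := GelfandDickey.curveHom_eq_zero_iff hΓ.isUnit_det hC hBC.1 h.hasDeg
  exact ⟨C, hC, GelfandDickey.trace_eq_zero hΓ hC fun s => by
      rw [← neg_neg s, mul_neg, h.traceless],
    GelfandDickey.isGreatest_col hcol, GelfandDickey.isGreatest_row hcol,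
    GelfandDickey.irreducible_charpoly hΓ.isUnit_det hC hBC.1 h.hasDeg,
    fun F => (GelfandDickey.annihilates_iff hS.isUnit h.lax.2 h.conj F).trans (hcurve F)⟩

theorem mainTheorem11 (n m : ℕ) (hn : 2 ≤ n)
    (γ : GelfandDickey.MatLoop n) (hγ : GelfandDickey.IsHalfLoop γ)
    (hnorm : GelfandDickey.IsNormalized γ)
    (hcell : GelfandDickey.InBigCell (GelfandDickey.loopSpace γ))
    (hBC : GelfandDickey.InBCLocus (GelfandDickey.loopSpace γ) m) :
    (∃ (S L M : GelfandDickey.PsiDO) (b : LaurentSeries ℂ),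
      GelfandDickey.IsBCData (GelfandDickey.loopSpace γ) m S L M b) ∧
    ∀ (S L M : GelfandDickey.PsiDO) (b : LaurentSeries ℂ),
      GelfandDickey.IsBCData (GelfandDickey.loopSpace γ) m S L M b →
      ∃ C : Matrix (Fin n) (Fin n) (Polynomial ℂ),
        GelfandDickey.polySeries C =
          (GelfandDickey.loopSeries γ)⁻¹ * GelfandDickey.evalLam b * GelfandDickey.loopSeries γ ∧
        C.trace = 0 ∧
        (∀ j, IsGreatest {d : ℤ | ∃ i, C i j ≠ 0 ∧
          d = ((i : ℕ) : ℤ) - ((j : ℕ) : ℤ) + n * (C i j).natDegree} m) ∧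
        (∀ i, IsGreatest {d : ℤ | ∃ j, C i j ≠ 0 ∧
          d = ((i : ℕ) : ℤ) - ((j : ℕ) : ℤ) + n * (C i j).natDegree} m) ∧
        Irreducible C.charpoly ∧
        ∀ F : Polynomial (Polynomial ℂ),
          GelfandDickey.Annihilates F L M ↔ C.charpoly ∣ F :=
  mainTheorem11_general n m hn γ (fun i j => hγ.memLp i j) hnorm hcell hBC
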